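/- **Theorem.** There is exactly one sequence of integers $(b_l)_{l\ge 0}$ with $$b_0=1,\qquad \sum_{l=0}^{p}(-1)^l\binom{p}{l}^2 b_l=0\quad\text{for all } p\ge 1$$ (OEIS A000275). As formal power series it satisfies $$\Bigl(\sum_{m\ge0}\frac{(-1)^m}{(m!)^2}z^m\Bigr)\Bigl(\sum_{l\ge0}\frac{b_l}{(l!)^2}z^l\Bigr)=1,$$ that is, $\sum_l b_l z^l/(l!)^2$ is the reciprocal of the Bessel function $J_0(2\sqrt z)$. Let $V$ be a complex vector space of finite dimension $n$ with a Hermitian inner product $h$ (linear in its first variable), and let $\omega=-\operatorname{Im}h$ be its positive $(1,1)$-form. Let $\bigwedge^*V^*=\bigoplus_{p,q}\bigwedge^{p,q}V^*$ be the exterior algebra of complex-valued forms on $V$, with the Hermitian inner product induced by $h$: if $e_1,\dots,e_{2n}$ is a basis of $V$ that is orthonormal for $\operatorname{Re}h$, with dual basis $e^1,\dots,e^{2n}$, then the monomials $e^{i_1}\wedge\dots\wedge e^{i_k}$, $i_1<\dots<i_k$, $0\le k\le 2n$, are an orthonormal basis. Let $Lu=\omega\wedge u$, let $\Lambda$ be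 the adjoint of $L$, and let $\mathbf I=\sum_{p,q}i^{p-q}\pi_{p,q}$, where $\pi_{p,q}$ is the orthogonal projection onto $\bigwedge^{p,q}V^*$. Write $A^{[m]}=A^m/m!$ for $m\ge0$, and $\omega^{[m]}=0$ for $m<0$. Then, for every $k\ge0$ and every $k$-form $u$ on $V$, $$(-1)^{k(k+1)/2}\,|u|^2\,\omega^{[n]}=\sum_{l=0}^{n}(-1)^l\,b_l\;\Lambda^{[l]}u\wedge\Lambda^{[l]}\,\overline{\mathbf I u}\wedge\omega^{[n-k+2l]}.$$ The integers $b_l$ do not depend on $V$, $n$, $k$ or $u$. -/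

import Mathlib

open scoped ComplexConjugate Nat
open Module

noncomputable section

namespace HermitianForms

/-- `A ^ m / m!` for an element `A` of a complex algebra. -/
def divPow {A : Type*} [Ring A] [Algebra ℂ A] (a : A) (m : ℕ) : A :=
  ((m ! : ℂ)⁻¹) • a ^ m

/-- `A ^ m / m!` for an integer exponent, with the convention that it is `0` for `m < 0`. -/
def divPowInt {A : Type*} [Ring A] [Algebra ℂ A] (a : A) (m : ℤ) : A :=
  if 0 ≤ m then divPow a m.toNat else 0

/-- The recursion `b 0 = 1` and `∑_{l ≤ p} (-1)^l (p choose l)^2 b l = 0` for all `p ≥ 1`. -/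
def IsRecipBesselSeq (b : ℕ → ℤ) : Prop :=
  b 0 = 1 ∧ ∀ p : ℕ, 1 ≤ p →
    ∑ l ∈ Finset.range (p + 1), (-1) ^ l * (p.choose l : ℤ) ^ 2 * b l = 0

variable (V : Type*) [NormedAddCommGroup V] [InnerProductSpace ℂ V]

/-- Complex-valued real-linear forms on `V`: the complexification of the real dual of `V`. -/
abbrev Covector : Type _ := V →ₗ[ℝ] ℂ

/-- The exterior algebra of complex-valued forms on `V`, with the wedge product as product.
Its submodule `⋀[ℂ]^k (Covector V)` consists of the `k`-forms. -/
abbrev Forms : Type _ := ExteriorAlgebra ℂ (Covector V)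

/-! ### Types and conjugation -/

/-- The complex-linear covectors, `⋀^{1,0}`. -/
def holCovectors : Submodule ℂ (Covector V) where
  carrier := {α | ∀ v, α (Complex.I • v) = Complex.I * α v}
  add_mem' {α β} hα hβ v := by
    simp only [Set.mem_ofPred_eq] at hα hβ
    simp only [LinearMap.add_apply, hα, hβ, mul_add]
  zero_mem' v := by simp
  smul_mem' c α hα v := by
    simp only [Set.mem_ofPred_eq] at hα
    simp only [LinearMap.smul_apply, hα, smul_eq_mul, mul_left_comm]

/-- The complex-antilinear covectors, `⋀^{0,1}`. -/
def antiholCovectors : Submodule ℂ (Covector V) where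
  carrier := {α | ∀ v, α (Complex.I • v) = -(Complex.I * α v)}
  add_mem' {α β} hα hβ v := by
    simp only [Set.mem_ofPred_eq] at hα hβ
    simp only [LinearMap.add_apply, hα, hβ, mul_add, neg_add]
  zero_mem' v := by simp
  smul_mem' c α hα v := by
    simp only [Set.mem_ofPred_eq] at hα
    simp only [LinearMap.smul_apply, hα, smul_eq_mul, mul_left_comm, mul_neg]

/-- The space of `(p,q)`-forms: the span of the products of `p` covectors of type `(1,0)`
and `q` covectors of type `(0,1)`. -/
def formsPQ (p q : ℕ) : Submodule ℂ (Forms V) :=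
  ((holCovectors V).map (ExteriorAlgebra.ι ℂ)) ^ p *
    ((antiholCovectors V).map (ExteriorAlgebra.ι ℂ)) ^ q

variable {V} in
/-- The conjugate of a covector, `v ↦ conj (α v)`. -/
def conjCovector (α : Covector V) : Covector V where
  toFun v := conj (α v)
  map_add' v w := by simp
  map_smul' c v := by simp

/-- The ring of forms, with complex scalars acting through their conjugates. -/
def ConjForms : Type _ := Forms V

instance : Ring (ConjForms V) := inferInstanceAs (Ring (Forms V))

instance : Algebra ℂ (ConjForms V) :=
  RingHom.toAlgebra' (R := ℂ) (S := ConjForms V)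
    ((algebraMap ℂ (Forms V)).comp (starRingEnd ℂ))
    (fun c x => Algebra.commutes (A := Forms V) (conj c) x)

theorem ConjForms.smul_def (c : ℂ) (x : ConjForms V) :
    c • x = ((conj c) • (show Forms V from x) : Forms V) :=
  (Algebra.smul_def (A := Forms V) (conj c) x).symm

/-- Conjugation of forms as an algebra homomorphism into the conjugate algebra: the multiplicative
extension of the conjugation of covectors. -/
def conjHom : Forms V →ₐ[ℂ] ConjForms V :=
  ExteriorAlgebra.lift ℂ
    ⟨{ toFun := fun α => (ExteriorAlgebra.ι ℂ (conjCovector α) : Forms V)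
       map_add' := fun α β => by
        have h : conjCovector (α + β) = conjCovector α + conjCovector β := by
          ext v; simp [conjCovector]
        rw [h, map_add]; rfl
       map_smul' := fun c α => by
        have h : conjCovector (c • α) = conj c • conjCovector α := by
          ext v; simp [conjCovector]
        exact (congrArg (ExteriorAlgebra.ι ℂ) h).trans
          ((map_smul _ _ _).trans (ConjForms.smul_def V c _).symm) },
     fun α => ExteriorAlgebra.ι_sq_zero (conjCovector α)⟩

/-- Complex conjugation of forms. -/
def conjForm : Forms V →ₛₗ[starRingEnd ℂ] Forms V where
  toFun := conjHom V
  map_add' := map_add (conjHom V)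
  map_smul' c u := (map_smul (conjHom V) c u).trans (ConjForms.smul_def V c _)

theorem conjForm_ι (α : Covector V) :
    conjForm V (ExteriorAlgebra.ι ℂ α) = ExteriorAlgebra.ι ℂ (conjCovector α) :=
  ExteriorAlgebra.lift_ι_apply ℂ (A := ConjForms V) _ _ α

theorem conjForm_one : conjForm V 1 = 1 := map_one (conjHom V)

theorem conjForm_mul (u v : Forms V) : conjForm V (u * v) = conjForm V u * conjForm V v := by
  change conjHom V (u * v) = (conjHom V u * conjHom V v : ConjForms V)
  rw [map_mul]

/-! ### The induced inner product -/

variable {V} in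
theorem repr_eq_re_inner {κ : Type*} [Fintype κ] [DecidableEq κ] (g : Basis κ ℝ V)
    (hg : ∀ i j, (inner ℂ (g i) (g j)).re = if i = j then 1 else 0) (v : V) (i : κ) :
    g.repr v i = (inner ℂ v (g i)).re := by
  conv_rhs => rw [← g.sum_repr v]
  simp [-Basis.sum_repr, hg]

variable [FiniteDimensional ℂ V]

/-- An orthonormal basis `e_1, …, e_n` of `V` for the Hermitian inner product. -/
def unitaryBasis : OrthonormalBasis (Fin (finrank ℂ V)) ℂ V := stdOrthonormalBasis ℂ V

/-- The real basis `e_1, i e_1, …, e_n, i e_n` of `V`, orthonormal for `Re h`, with its indices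
`(j, 0)` and `(j, 1)` in lexicographic order. -/
def realBasis : Basis (Fin (finrank ℂ V) ×ₗ Fin 2) ℝ V :=
  (Complex.basisOneI.smulTower' (unitaryBasis V).toBasis).reindex toLex

theorem realBasis_zero (j : Fin (finrank ℂ V)) :
    realBasis V (toLex (j, 0)) = unitaryBasis V j := by
  simp [realBasis, Basis.smulTower'_apply]

theorem realBasis_one (j : Fin (finrank ℂ V)) :
    realBasis V (toLex (j, 1)) = Complex.I • unitaryBasis V j := by
  simp [realBasis, Basis.smulTower'_apply]

/-- The dual coframe `dx_1, dy_1, …, dx_n, dy_n`, as a complex basis of the complex-valued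
covectors. -/
def coframe : Basis (Fin (finrank ℂ V) ×ₗ Fin 2) ℂ (Covector V) :=
  Basis.ofEquivFun ((realBasis V).constr ℂ).symm

theorem coframe_repr (α : Covector V) (i : Fin (finrank ℂ V) ×ₗ Fin 2) :
    (coframe V).repr α i = α (realBasis V i) := by
  simp [coframe, Basis.constr]

theorem coframe_apply_realBasis (i j : Fin (finrank ℂ V) ×ₗ Fin 2) :
    coframe V i (realBasis V j) = if i = j then 1 else 0 := by
  rw [← coframe_repr, Basis.repr_self, Finsupp.single_apply]

/-- The basis of the exterior algebra that consists of the ordered monomials in the coframe. -/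
def formBasis : Basis (Finset (Fin (finrank ℂ V) ×ₗ Fin 2)) ℂ (Forms V) :=
  (coframe V).ExteriorAlgebra

instance : FiniteDimensional ℂ (Forms V) := (formBasis V).finiteDimensional_of_finite

/-- The Hermitian inner product on forms induced by `h`: the monomials in an orthonormal real
coframe are an orthonormal basis. By `inner_ιMulti` and `covectorInner_eq` it does not depend
on the coframe. As always in Mathlib, it is conjugate-linear in the first variable. -/
@[reducible]
def formsCore : InnerProductSpace.Core ℂ (Forms V) where
  inner u v := ∑ s, conj ((formBasis V).repr u s) * (formBasis V).repr v s
  conj_inner_symm u v := by simp [map_sum, mul_comm]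
  re_inner_nonneg u := by
    rw [map_sum]
    refine Finset.sum_nonneg fun s _ => ?_
    rw [← Complex.normSq_eq_conj_mul_self]
    exact Complex.normSq_nonneg _
  add_left u v w := by simp [add_mul, Finset.sum_add_distrib]
  smul_left u v c := by simp [Finset.mul_sum, mul_assoc]
  definite u hu := by
    have h : ∑ s, Complex.normSq ((formBasis V).repr u s) = 0 := by
      have := hu
      simp_rw [← Complex.normSq_eq_conj_mul_self] at this
      exact_mod_cast this
    rw [Finset.sum_eq_zero_iff_of_nonneg fun s _ => Complex.normSq_nonneg _] at h
    apply (formBasis V).repr.injective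
    ext s
    simpa using h s (Finset.mem_univ s)

instance : NormedAddCommGroup (Forms V) := (formsCore V).toNormedAddCommGroup

instance : InnerProductSpace ℂ (Forms V) := InnerProductSpace.ofCore (formsCore V).toCore

theorem inner_def (u v : Forms V) :
    inner ℂ u v = ∑ s, conj ((formBasis V).repr u s) * (formBasis V).repr v s := rfl

variable {V} in
/-- The induced Hermitian inner product of covectors. -/
def covectorInner (α β : Covector V) : ℂ := ∑ i, conj (α (realBasis V i)) * β (realBasis V i)

/-- The inner product of two monomials is the Gram determinant. -/
theorem inner_ιMulti {k : ℕ} (a b : Fin k → Covector V) :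
    inner ℂ (ExteriorAlgebra.ιMulti ℂ k a) (ExteriorAlgebra.ιMulti ℂ k b) =
      (Matrix.of fun i j => covectorInner (a i) (b j)).det := by
  have hlin : ∀ α : Covector V, ∃ f : Module.Dual ℂ (Covector V),
      ∀ β, f β = covectorInner α β := fun α =>
    ⟨{ toFun := covectorInner α
       map_add' := fun β γ => by simp [covectorInner, mul_add, Finset.sum_add_distrib]
       map_smul' := fun c β => by simp [covectorInner, Finset.mul_sum, mul_left_comm] },
      fun _ => rfl⟩
  choose F hF using hlin
  have hbasis : ∀ (α : Covector V) i, covectorInner α (coframe V i) = conj (α (realBasis V i)) := by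
    intro α i
    simp [covectorInner, coframe_apply_realBasis]
  have hcoe : ∀ t : Set.powersetCard (Fin (finrank ℂ V) ×ₗ Fin 2) k,
      ((exteriorPower.ιMulti_family ℂ k (coframe V) t : ⋀[ℂ]^k (Covector V)) : Forms V) =
        formBasis V t := by
    intro t
    rw [formBasis, ExteriorAlgebra.basis_eq_coe_basis, exteriorPower.basis_apply]
  have hrepr : ∀ s, ((formBasis V).coord (s : Set.powersetCard _ k)).comp
      (⋀[ℂ]^k (Covector V)).subtype = exteriorPower.ιMultiDual ℂ k (coframe V) s := by
    intro s
    refine ((coframe V).exteriorPower k).ext fun t => ?_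
    rw [exteriorPower.basis_apply, LinearMap.comp_apply, Submodule.subtype_apply, hcoe,
      Basis.coord_apply, Basis.repr_self, Finsupp.single_apply]
    split_ifs with h
    · rw [Subtype.ext h, exteriorPower.ιMultiDual_apply_diag]
    · rw [exteriorPower.ιMultiDual_apply_nondiag]
      exact fun h' => h (by rw [h'])
  have hmain : (∑ s, conj ((formBasis V).repr (ExteriorAlgebra.ιMulti ℂ k a) s) •
      (formBasis V).coord s).comp (⋀[ℂ]^k (Covector V)).subtype =
      exteriorPower.pairingDual ℂ (Covector V) k (exteriorPower.ιMulti ℂ k fun i => F (a i)) := by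
    refine ((coframe V).exteriorPower k).ext fun t => ?_
    rw [exteriorPower.basis_apply, LinearMap.comp_apply, Submodule.subtype_apply, hcoe]
    have h1 := LinearMap.congr_fun (hrepr t) (exteriorPower.ιMulti ℂ k a)
    rw [exteriorPower.ιMultiDual_apply_ιMulti, LinearMap.comp_apply, Submodule.subtype_apply,
      Basis.coord_apply, exteriorPower.ιMulti_apply_coe] at h1
    simp only [LinearMap.sum_apply, LinearMap.smul_apply, Basis.coord_apply, Basis.repr_self,
      Finsupp.single_apply, smul_eq_mul, mul_ite, mul_one, mul_zero, Finset.sum_ite_eq,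
      Finset.mem_univ, if_true]
    rw [h1, exteriorPower.ιMulti_family, exteriorPower.pairingDual_ιMulti_ιMulti,
      ← Matrix.det_transpose, RingHom.map_det]
    congr 1
    ext i j
    simp [hF, hbasis, coframe_repr]
  have h2 := LinearMap.congr_fun hmain (exteriorPower.ιMulti ℂ k b)
  rw [exteriorPower.pairingDual_ιMulti_ιMulti, LinearMap.comp_apply, Submodule.subtype_apply,
    exteriorPower.ιMulti_apply_coe] at h2
  rw [inner_def, ← Matrix.det_transpose]
  simpa [hF, Matrix.transpose] using h2

theorem re_inner_realBasis (i j : Fin (finrank ℂ V) ×ₗ Fin 2) :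
    (inner ℂ (realBasis V i) (realBasis V j)).re = if i = j then 1 else 0 := by
  obtain ⟨⟨i, a⟩, rfl⟩ := toLex.surjective i
  obtain ⟨⟨j, b⟩, rfl⟩ := toLex.surjective j
  have h := orthonormal_iff_ite.mp (unitaryBasis V).orthonormal i j
  fin_cases a <;> fin_cases b <;>
    simp [realBasis_zero, realBasis_one, h, apply_ite]

/-- Any real basis of `V` that is orthonormal for `Re h` gives the same inner product. -/
theorem covectorInner_eq {κ : Type*} [Fintype κ] [DecidableEq κ] (f : Basis κ ℝ V)
    (hf : ∀ i j, (inner ℂ (f i) (f j)).re = if i = j then 1 else 0) (α β : Covector V) :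
    covectorInner α β = ∑ i, conj (α (f i)) * β (f i) := by
  have hsymm : ∀ x y : V, (inner ℂ x y).re = (inner ℂ y x).re := fun x y => by
    rw [← inner_conj_symm, Complex.conj_re]
  have hR : ∀ (γ : Covector V) v,
      γ v = ∑ k, ((inner ℂ v (realBasis V k)).re : ℂ) * γ (realBasis V k) := by
    intro γ v
    conv_lhs => rw [← (realBasis V).sum_repr v]
    simp [-Basis.sum_repr, repr_eq_re_inner _ (re_inner_realBasis V)]
  have hF : ∀ (γ : Covector V) v, γ v = ∑ i, ((inner ℂ v (f i)).re : ℂ) * γ (f i) := by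
    intro γ v
    conv_lhs => rw [← f.sum_repr v]
    simp [-Basis.sum_repr, repr_eq_re_inner _ hf]
  calc covectorInner α β
      = ∑ k, ∑ i, conj (α (realBasis V k)) *
          (((inner ℂ (realBasis V k) (f i)).re : ℂ) * β (f i)) := by
        simp_rw [covectorInner, ← Finset.mul_sum, ← hF]
    _ = ∑ i, (∑ k, conj (((inner ℂ (f i) (realBasis V k)).re : ℂ) * α (realBasis V k))) *
          β (f i) := by
        rw [Finset.sum_comm]
        refine Finset.sum_congr rfl fun i _ => ?_
        rw [Finset.sum_mul]
        refine Finset.sum_congr rfl fun k _ => ?_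
        rw [hsymm, map_mul, Complex.conj_ofReal]
        ring
    _ = ∑ i, conj (α (f i)) * β (f i) := by
        simp_rw [← map_sum, ← hR]

/-! ### The operators -/

/-- The positive `(1,1)`-form `ω = -Im h = ∑ dx_j ∧ dy_j`. -/
def omega : Forms V :=
  ∑ j, ExteriorAlgebra.ι ℂ (coframe V (toLex (j, 0))) *
    ExteriorAlgebra.ι ℂ (coframe V (toLex (j, 1)))

variable {V} in
/-- Evaluation of forms on `k` vectors, which sends `α_1 ∧ ⋯ ∧ α_k` to `det (α_i (v_j))`. -/
def evalForm {k : ℕ} (v : Fin k → V) : Forms V →ₗ[ℂ] ℂ :=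
  ExteriorAlgebra.liftAlternating (Pi.single k
    ((Matrix.detRowAlternating (R := ℂ) (n := Fin k)).compLinearMap
      { toFun := fun α j => α (v j), map_add' := fun _ _ => rfl, map_smul' := fun _ _ => rfl }))

/-- `ω = -Im h`. In Mathlib's convention `inner ℂ v w` is `h(w, v)`, the complex conjugate
of `h(v, w)`. -/
theorem evalForm_omega (v w : V) :
    evalForm ![v, w] (omega V) = ((inner ℂ v w).im : ℂ) := by
  have hc : ∀ i (v : V), coframe V i v = ((inner ℂ v (realBasis V i)).re : ℂ) := by
    intro i v
    conv_lhs => rw [← (realBasis V).sum_repr v]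
    simp [-Basis.sum_repr, coframe_apply_realBasis,
      repr_eq_re_inner _ (re_inner_realBasis V)]
  have hx : ∀ (j : Fin (finrank ℂ V)) (v : V),
      coframe V (toLex (j, 0)) v = ((inner ℂ (unitaryBasis V j) v).re : ℂ) := by
    intro j v
    rw [hc, realBasis_zero, ← inner_conj_symm, Complex.conj_re]
  have hy : ∀ (j : Fin (finrank ℂ V)) (v : V),
      coframe V (toLex (j, 1)) v = ((inner ℂ (unitaryBasis V j) v).im : ℂ) := by
    intro j v
    rw [hc, realBasis_one, inner_smul_right, Complex.I_mul_re, ← inner_conj_symm v,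
      Complex.conj_im, neg_neg]
  have hmul : ∀ α β : Covector V,
      evalForm ![v, w] (ExteriorAlgebra.ι ℂ α * ExteriorAlgebra.ι ℂ β) =
        α v * β w - α w * β v := by
    intro α β
    have h : (ExteriorAlgebra.ι ℂ α * ExteriorAlgebra.ι ℂ β : Forms V) =
        ExteriorAlgebra.ιMulti ℂ 2 ![α, β] := by
      simp [ExteriorAlgebra.ιMulti_apply]
    rw [h, evalForm, ExteriorAlgebra.liftAlternating_apply_ιMulti, Pi.single_eq_same]
    refine (Matrix.det_fin_two (Matrix.of fun i j => ![α, β] i (![v, w] j))).trans ?_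
    simp
  rw [omega, map_sum, ← (unitaryBasis V).sum_inner_mul_inner v w, Complex.im_sum,
    Complex.ofReal_sum]
  refine Finset.sum_congr rfl fun j _ => ?_
  rw [hmul, hx, hx, hy, hy, ← inner_conj_symm v (unitaryBasis V j)]
  simp only [Complex.mul_im, Complex.conj_re, Complex.conj_im]
  push_cast
  ring

/-- The Lefschetz operator `L u = ω ∧ u`. -/
def lefschetz : Forms V →ₗ[ℂ] Forms V := LinearMap.mulLeft ℂ (omega V)

/-- The adjoint of the Lefschetz operator. -/
def lefschetzAdjoint : Forms V →ₗ[ℂ] Forms V := LinearMap.adjoint (lefschetz V)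

/-- The orthogonal projection of forms onto the `(p,q)`-forms. -/
def projPQ (p q : ℕ) : Forms V →ₗ[ℂ] Forms V := (formsPQ V p q).starProjection.toLinearMap

/-- The operator `𝐈 = ∑_{p,q} i^{p-q} π_{p,q}`. -/
def weilOp : Forms V →ₗ[ℂ] Forms V :=
  ∑ p ∈ Finset.range (finrank ℂ V + 1), ∑ q ∈ Finset.range (finrank ℂ V + 1),
    (Complex.I ^ ((p : ℤ) - (q : ℤ))) • projPQ V p q

end HermitianForms
end

noncomputable section

namespace HermitianForms

open ExteriorAlgebra (ι ιMulti)

/-! ### Degrees and interior products -/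

section Interior

variable {V : Type*} [NormedAddCommGroup V] [InnerProductSpace ℂ V]

/-! Write `J` for the antilinear map `conjRot` on covectors (so `J² = -1`), `C` for its
multiplicative extension `conjWeil`, and `σ` for the anti-automorphism `antiInvolution`. The core is
one polarized identity valid in all degrees at once, `inner_volume_expOmega_antiInvolution`:
`⟪ω^[n], e^ω ∧ σ(y) ∧ C x⟫ = ⟪e^Λ x, e^{-Λ} y⟫`. It is proved by moving the covector factors of `y`
one at a time over to `x`. On the left, a factor `α` of `y` becomes a factor `Jα` of `x`. On the
right, `e^{tΛ}` turns `α ∧` into `α ∧ - t i_{Jα}` (`expLefschetzAdjoint_ι_mul`), and the two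
operators that appear are adjoint to each other. The case `y = 1` amounts to `e^Λ ω^[n] = e^ω` and
to the antiunitarity of `C`. For `x = y = Λ^[l] u` the identity expands the `l`-th wedge term of the
theorem, up to sign, as `∑_m (-1)^m (m+l choose l)² |Λ^[m+l] u|²`. Summing against `b_l`, the
coefficient of `|Λ^[p] u|²` is, up to sign, the sum in the recursion, so that only `p = 0` survives
(`sum_mul_sum_choose_sq`). This requires `𝐈`, defined by orthogonal projections, to be
multiplicative: `weilOp_eq_map_rot` identifies it with the extension of `α ↦ α(i ·)`. -/

/-- Forms are spanned by products of covectors. -/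
theorem forms_induction {P : Forms V → Prop} (h0 : P 0) (hadd : ∀ x y, P x → P y → P (x + y))
    (hsmul : ∀ (c : ℂ) x, P x → P (c • x))
    (hmulti : ∀ (k : ℕ) (a : Fin k → Covector V), P (ιMulti ℂ k a)) (x : Forms V) : P x := by
  have hx : x ∈ Submodule.span ℂ (Set.range fun x : Σ n, (Fin n → Covector V) =>
      ιMulti ℂ x.1 x.2) := by
    rw [ExteriorAlgebra.ιMulti_span]; trivial
  induction hx using Submodule.span_induction with
  | mem x h => obtain ⟨y, rfl⟩ := h; exact hmulti _ _
  | zero => exact h0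
  | add x y _ _ hx hy => exact hadd x y hx hy
  | smul c x _ hx => exact hsmul c x hx

/-- Forms of degree `k` are spanned by products of `k` covectors. -/
theorem forms_degree_induction {k : ℕ} {P : Forms V → Prop} (h0 : P 0)
    (hadd : ∀ x y, P x → P y → P (x + y)) (hsmul : ∀ (c : ℂ) x, P x → P (c • x))
    (hmulti : ∀ a : Fin k → Covector V, P (ιMulti ℂ k a)) {x : Forms V}
    (hx : x ∈ ⋀[ℂ]^k (Covector V)) : P x := by
  rw [← ExteriorAlgebra.ιMulti_span_fixedDegree] at hx
  induction hx using Submodule.span_induction with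
  | mem x h => obtain ⟨y, rfl⟩ := h; exact hmulti _
  | zero => exact h0
  | add x y _ _ hx hy => exact hadd x y hx hy
  | smul c x _ hx => exact hsmul c x hx

theorem ιMulti_mem_degree {k : ℕ} (a : Fin k → Covector V) :
    (ιMulti ℂ k a : Forms V) ∈ ⋀[ℂ]^k (Covector V) :=
  ExteriorAlgebra.ιMulti_range ℂ k ⟨a, rfl⟩

theorem ι_mem_degree_one (α : Covector V) : (ι ℂ α : Forms V) ∈ ⋀[ℂ]^1 (Covector V) := by
  rw [ExteriorAlgebra.exteriorPower, pow_one]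
  exact LinearMap.mem_range_self _ α

theorem mul_mem_degree {j k : ℕ} {x y : Forms V} (hx : x ∈ ⋀[ℂ]^j (Covector V))
    (hy : y ∈ ⋀[ℂ]^k (Covector V)) : x * y ∈ ⋀[ℂ]^(j + k) (Covector V) := by
  rw [ExteriorAlgebra.exteriorPower, pow_add]
  exact Submodule.mul_mem_mul hx hy

theorem ιMulti_succ_eq {k : ℕ} (a : Fin (k + 1) → Covector V) :
    (ιMulti ℂ (k + 1) a : Forms V) = ι ℂ (a 0) * ιMulti ℂ k (fun i => a i.succ) :=
  ExteriorAlgebra.ιMulti_succ_apply a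

variable [FiniteDimensional ℂ V]

/-- The linear functional `β ↦ ⟪α, β⟫` on covectors. -/
def flat (α : Covector V) : Module.Dual ℂ (Covector V) where
  toFun := covectorInner α
  map_add' β γ := by simp [covectorInner, mul_add, Finset.sum_add_distrib]
  map_smul' c β := by simp [covectorInner, Finset.mul_sum, mul_left_comm]

/-- The interior product with the functional `β ↦ ⟪α, β⟫`. -/
def interior (α : Covector V) : Forms V →ₗ[ℂ] Forms V :=
  CliffordAlgebra.contractLeft (Q := (0 : QuadraticForm ℂ (Covector V))) (flat α)

theorem interior_ι_mul (α β : Covector V) (x : Forms V) :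
    interior α (ι ℂ β * x) = covectorInner α β • x - ι ℂ β * interior α x :=
  CliffordAlgebra.contractLeft_ι_mul (flat α) β x

theorem interior_one (α : Covector V) : interior α (1 : Forms V) = 0 :=
  CliffordAlgebra.contractLeft_one 0 (flat α)

theorem interior_ιMulti (α : Covector V) {k : ℕ} (a : Fin (k + 1) → Covector V) :
    interior α (ιMulti ℂ (k + 1) a) =
      ∑ j : Fin (k + 1), ((-1 : ℂ) ^ (j : ℕ) * covectorInner α (a j)) •
        ιMulti ℂ k (fun i => a (j.succAbove i)) := by
  induction k with
  | zero =>
    rw [ιMulti_succ_eq, interior_ι_mul, ExteriorAlgebra.ιMulti_zero_apply, interior_one]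
    simp [ExteriorAlgebra.ιMulti_zero_apply]
  | succ k ih =>
    rw [ιMulti_succ_eq, interior_ι_mul, ih, Fin.sum_univ_succ (n := k + 1), Finset.mul_sum,
      sub_eq_add_neg, ← Finset.sum_neg_distrib]
    congr 1
    · simp
    · refine Finset.sum_congr rfl fun j _ => ?_
      rw [ιMulti_succ_eq (fun i => a (j.succ.succAbove i))]
      simp only [Fin.succ_succAbove_zero, Fin.succ_succAbove_succ, Fin.val_succ, pow_succ,
        mul_smul_comm]
      rw [← neg_smul]
      congr 1
      ring

theorem interior_mem_degree (α : Covector V) {k : ℕ} {x : Forms V}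
    (hx : x ∈ ⋀[ℂ]^(k + 1) (Covector V)) : interior α x ∈ ⋀[ℂ]^k (Covector V) := by
  refine forms_degree_induction (P := fun x => interior α x ∈ ⋀[ℂ]^k (Covector V))
    (by simp) (fun x y hx hy => ?_) (fun c x hx => ?_) (fun a => ?_) hx
  · rw [map_add]; exact add_mem hx hy
  · rw [map_smul]; exact Submodule.smul_mem _ _ hx
  · rw [interior_ιMulti]
    exact Submodule.sum_mem _ fun j _ => Submodule.smul_mem _ _ (ιMulti_mem_degree _)

theorem interior_degree_zero (α : Covector V) {x : Forms V}
    (hx : x ∈ ⋀[ℂ]^0 (Covector V)) : interior α x = 0 := by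
  refine forms_degree_induction (P := fun x => interior α x = 0)
    (by simp) (fun x y hx hy => ?_) (fun c x hx => ?_) (fun a => ?_) hx
  · rw [map_add, hx, hy, add_zero]
  · rw [map_smul, hx, smul_zero]
  · rw [ExteriorAlgebra.ιMulti_zero_apply, interior_one]

theorem formBasis_mem_degree (s : Finset (Fin (finrank ℂ V) ×ₗ Fin 2)) :
    formBasis V s ∈ ⋀[ℂ]^(s.card) (Covector V) := by
  rw [formBasis, ExteriorAlgebra.basis_apply]
  exact ιMulti_mem_degree _

/-- The expansion of `x` in the monomial basis of `⋀^k` is also its expansion in `formBasis`, so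
only index sets with `k` elements occur. -/
theorem formBasis_repr_eq_zero {k : ℕ} {x : Forms V} (hx : x ∈ ⋀[ℂ]^k (Covector V))
    {s : Finset (Fin (finrank ℂ V) ×ₗ Fin 2)} (hs : s.card ≠ k) :
    (formBasis V).repr x s = 0 := by
  have h := ((coframe V).exteriorPower k).sum_repr ⟨x, hx⟩
  have h' := congrArg (Subtype.val) h
  change _ = x at h'
  rw [← h']
  simp only [Submodule.coe_sum, Submodule.coe_smul, map_sum, map_smul, Finsupp.coe_finsetSum,
    Finset.sum_apply]
  refine Finset.sum_eq_zero fun t _ => ?_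
  rw [← ExteriorAlgebra.basis_eq_coe_basis]
  change _ * (formBasis V).repr (formBasis V t) s = 0
  rw [Basis.repr_self, Finsupp.single_apply, if_neg, mul_zero]
  rintro rfl
  exact hs t.2

/-- Forms of different degrees are orthogonal. -/
theorem inner_eq_zero_of_degree_ne {j k : ℕ} (hjk : j ≠ k) {x y : Forms V}
    (hx : x ∈ ⋀[ℂ]^j (Covector V)) (hy : y ∈ ⋀[ℂ]^k (Covector V)) : inner ℂ x y = 0 := by
  rw [inner_def]
  refine Finset.sum_eq_zero fun s _ => ?_
  by_cases hs : s.card = j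
  · rw [formBasis_repr_eq_zero hy (hs ▸ hjk), mul_zero]
  · rw [formBasis_repr_eq_zero hx hs, map_zero, zero_mul]

theorem degree_eq_zero {k : ℕ} (hk : 2 * finrank ℂ V < k) {x : Forms V}
    (hx : x ∈ ⋀[ℂ]^k (Covector V)) : x = 0 := by
  apply (formBasis V).repr.injective
  ext s
  rw [map_zero, Finsupp.zero_apply]
  refine formBasis_repr_eq_zero hx fun h => ?_
  have := s.card_le_univ
  rw [Fintype.card_lex, Fintype.card_prod, Fintype.card_fin, Fintype.card_fin] at this
  omega

/-- Multiplication by a covector is adjoint to the interior product. -/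
theorem inner_ι_mul_left (α : Covector V) (x y : Forms V) :
    inner ℂ (ι ℂ α * x) y = inner ℂ x (interior α y) := by
  refine forms_induction (P := fun x => inner ℂ (ι ℂ α * x) y = inner ℂ x (interior α y))
    (by simp) (fun x z hx hz => ?_) (fun c x hx => ?_) (fun j a => ?_) x
  · simp only [mul_add, inner_add_left, hx, hz]
  · simp only [mul_smul_comm, inner_smul_left, hx]
  refine forms_induction (P := fun y => inner ℂ (ι ℂ α * ιMulti ℂ j a) y =
    inner ℂ (ιMulti ℂ j a : Forms V) (interior α y))
    (by simp) (fun x z hx hz => ?_) (fun c x hx => ?_) (fun k b => ?_) y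
  · simp only [map_add, inner_add_right, hx, hz]
  · simp only [map_smul, inner_smul_right, hx]
  have hα : (ι ℂ α * ιMulti ℂ j a : Forms V) = ιMulti ℂ (j + 1) (Fin.cons α a) := by
    rw [ιMulti_succ_eq]; simp
  by_cases hjk : j + 1 = k
  · subst hjk
    -- The alternating sum for the interior product is the Laplace expansion of the Gram determinant
    -- along the row of `α`.
    rw [hα, inner_ιMulti, interior_ιMulti, inner_sum, Matrix.det_succ_row_zero]
    refine Finset.sum_congr rfl fun i _ => ?_
    rw [inner_smul_right, inner_ιMulti]
    congr 1
  · rw [hα, inner_eq_zero_of_degree_ne hjk (ιMulti_mem_degree _) (ιMulti_mem_degree _)]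
    cases k with
    | zero => rw [interior_degree_zero α (ιMulti_mem_degree _), inner_zero_right]
    | succ k =>
      rw [inner_eq_zero_of_degree_ne (fun h => hjk (by rw [h])) (ιMulti_mem_degree _)
        (interior_mem_degree α (ιMulti_mem_degree _))]

theorem inner_ι_mul_right (α : Covector V) (x y : Forms V) :
    inner ℂ x (ι ℂ α * y) = inner ℂ (interior α x) y := by
  rw [← inner_conj_symm, inner_ι_mul_left, inner_conj_symm]

end Interior

/-! ### The decomposition into types and the operator `𝐈` -/

section Types

variable {V : Type*} [NormedAddCommGroup V] [InnerProductSpace ℂ V]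

/-- The operator `α ↦ α (i ·)` on covectors. -/
def rot : Covector V →ₗ[ℂ] Covector V where
  toFun α :=
    { toFun := fun v => α (Complex.I • v)
      map_add' := fun v w => by simp
      map_smul' := fun c v => by rw [smul_comm, map_smul, RingHom.id_apply] }
  map_add' _ _ := rfl
  map_smul' _ _ := rfl

theorem rot_apply (α : Covector V) (v : V) : rot α v = α (Complex.I • v) := rfl

theorem rot_rot (α : Covector V) : rot (rot α) = -α := by
  ext v
  simp [rot_apply, smul_smul]

theorem mem_holCovectors_iff {α : Covector V} :
    α ∈ holCovectors V ↔ rot α = Complex.I • α :=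
  ⟨fun h => LinearMap.ext h, fun h v => LinearMap.congr_fun h v⟩

theorem mem_antiholCovectors_iff {α : Covector V} :
    α ∈ antiholCovectors V ↔ rot α = -(Complex.I • α) :=
  ⟨fun h => LinearMap.ext h, fun h v => LinearMap.congr_fun h v⟩

/-- The operator on covectors with eigenvalue `a` on `⋀^{1,0}` and `b` on `⋀^{0,1}`. -/
def typeScale (a b : ℂ) : Covector V →ₗ[ℂ] Covector V :=
  -- The projections onto the two types are `(1 - i rot)/2` and `(1 + i rot)/2`; this is `a` times
  -- the first plus `b` times the second.
  ((a + b) / 2) • LinearMap.id - (Complex.I * ((a - b) / 2)) • rot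

theorem typeScale_apply (a b : ℂ) (α : Covector V) :
    typeScale a b α = ((a + b) / 2) • α - (Complex.I * ((a - b) / 2)) • rot α := rfl

theorem typeScale_hol (a b : ℂ) {α : Covector V} (hα : α ∈ holCovectors V) :
    typeScale a b α = a • α := by
  rw [typeScale_apply, mem_holCovectors_iff.mp hα, smul_smul, ← sub_smul]
  congr 1
  linear_combination (-(a - b) / 2) * Complex.I_mul_I

theorem typeScale_antihol (a b : ℂ) {α : Covector V} (hα : α ∈ antiholCovectors V) :
    typeScale a b α = b • α := by
  rw [typeScale_apply, mem_antiholCovectors_iff.mp hα, smul_neg, sub_neg_eq_add, smul_smul,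
    ← add_smul]
  congr 1
  linear_combination ((a - b) / 2) * Complex.I_mul_I

theorem exists_hol_add_antihol (α : Covector V) :
    ∃ β ∈ holCovectors V, ∃ γ ∈ antiholCovectors V, α = β + γ := by
  refine ⟨typeScale 1 0 α, ?_, typeScale 0 1 α, ?_, ?_⟩
  · rw [mem_holCovectors_iff]
    ext v
    simp [typeScale_apply, map_sub, map_smul, rot_rot]
    linear_combination ((rot α v) / 2) * Complex.I_mul_I
  · rw [mem_antiholCovectors_iff]
    ext v
    simp [typeScale_apply, map_sub, map_smul, rot_rot]
    linear_combination ((rot α v) / 2) * Complex.I_mul_I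
  · ext v
    simp [typeScale_apply]
    ring

theorem algHom_apply_of_mem_pow {A : Type*} [Ring A] [Algebra ℂ A] (f : A →ₐ[ℂ] A) (a : ℂ)
    {M : Submodule ℂ A} (hM : ∀ m ∈ M, f m = a • m) (p : ℕ) {x : A} (hx : x ∈ M ^ p) :
    f x = a ^ p • x := by
  induction p generalizing x with
  | zero =>
    obtain ⟨c, rfl⟩ := Submodule.mem_one.mp (by simpa using hx)
    simp
  | succ p ih =>
    rw [pow_succ] at hx
    induction hx using Submodule.mul_induction_on' with
    | mem_mul_mem m hm n hn =>
      rw [map_mul, ih hm, hM n hn, smul_mul_smul_comm, pow_succ]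
    | add x _ y _ hx hy => rw [map_add, hx, hy, smul_add]

theorem map_apply_of_mem_formsPQ (f : Covector V →ₗ[ℂ] Covector V) (a b : ℂ)
    (ha : ∀ α ∈ holCovectors V, f α = a • α) (hb : ∀ α ∈ antiholCovectors V, f α = b • α)
    {p q : ℕ} {x : Forms V} (hx : x ∈ formsPQ V p q) :
    ExteriorAlgebra.map f x = (a ^ p * b ^ q) • x := by
  induction hx using Submodule.mul_induction_on' with
  | mem_mul_mem m hm n hn =>
    rw [map_mul, algHom_apply_of_mem_pow _ a _ p hm, algHom_apply_of_mem_pow _ b _ q hn,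
      smul_mul_smul_comm]
    · rintro _ ⟨α, hα, rfl⟩
      rw [ExteriorAlgebra.map_apply_ι, hb α hα, map_smul]
    · rintro _ ⟨α, hα, rfl⟩
      rw [ExteriorAlgebra.map_apply_ι, ha α hα, map_smul]
  | add x _ y _ hx hy => rw [map_add, hx, hy, smul_add]

theorem ι_mul_ι_comm (α β : Covector V) :
    (ι ℂ α * ι ℂ β : Forms V) = -(ι ℂ β * ι ℂ α) :=
  eq_neg_of_add_eq_zero_left (ExteriorAlgebra.ι_add_mul_swap α β)

/-- `formsPQ` puts the `(1,0)` factors first; this lets a new `(0,1)` factor move past them. -/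
theorem commute_map_ι (M N : Submodule ℂ (Covector V)) :
    Commute (M.map (ι ℂ : _ →ₗ[ℂ] Forms V)) (N.map (ι ℂ)) := by
  have h : ∀ M N : Submodule ℂ (Covector V),
      M.map (ι ℂ : _ →ₗ[ℂ] Forms V) * N.map (ι ℂ) ≤ N.map (ι ℂ) * M.map (ι ℂ) := by
    intro M N
    rw [Submodule.mul_le]
    rintro _ ⟨α, hα, rfl⟩ _ ⟨β, hβ, rfl⟩
    rw [ι_mul_ι_comm]
    exact neg_mem (Submodule.mul_mem_mul ⟨β, hβ, rfl⟩ ⟨α, hα, rfl⟩)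
  exact le_antisymm (h M N) (h N M)

/-- Forms are sums of forms of pure type. -/
theorem formsPQ_induction {P : Forms V → Prop} (hadd : ∀ x y, P x → P y → P (x + y))
    (hPQ : ∀ p q, ∀ x ∈ formsPQ V p q, P x) (x : Forms V) : P x := by
  have hx : x ∈ ⨆ pq : ℕ × ℕ, formsPQ V pq.1 pq.2 := by
    induction x using CliffordAlgebra.left_induction with
    | algebraMap r =>
      refine Submodule.mem_iSup_of_mem (0, 0) ?_
      simp only [formsPQ, pow_zero, mul_one]
      exact Submodule.algebraMap_mem r
    | add x y hx hy => exact add_mem hx hy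
    | ι_mul x α hx =>
      induction hx using Submodule.iSup_induction' with
      | zero => rw [mul_zero]; exact zero_mem _
      | add x y _ _ hx hy => rw [mul_add]; exact add_mem hx hy
      | mem pq x hx =>
        obtain ⟨β, hβ, γ, hγ, rfl⟩ := exists_hol_add_antihol α
        rw [map_add, add_mul]
        refine add_mem ?_ ?_
        · refine Submodule.mem_iSup_of_mem (pq.1 + 1, pq.2) ?_
          simp only [formsPQ, pow_succ', mul_assoc]
          exact Submodule.mul_mem_mul ⟨β, hβ, rfl⟩ hx
        · refine Submodule.mem_iSup_of_mem (pq.1, pq.2 + 1) ?_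
          simp only [formsPQ]
          rw [pow_succ', ← mul_assoc, ((commute_map_ι _ _).pow_left _).eq, mul_assoc]
          exact Submodule.mul_mem_mul ⟨γ, hγ, rfl⟩ hx
  induction hx using Submodule.iSup_induction' with
  | zero => exact hPQ 0 0 0 (zero_mem _)
  | add x y _ _ hx hy => exact hadd x y hx hy
  | mem pq x hx => exact hPQ _ _ _ hx

/-- The operator `α ↦ conj (α (i ·))` on covectors. -/
def conjRot (α : Covector V) : Covector V := conjCovector (rot α)

theorem conjRot_conjRot (α : Covector V) : conjRot (conjRot α) = -α := by
  ext v
  simp [conjRot, conjCovector, rot_apply, smul_smul]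

variable [FiniteDimensional ℂ V]

theorem covectorInner_eq_sum (α β : Covector V) :
    covectorInner α β = ∑ j, (conj (α (unitaryBasis V j)) * β (unitaryBasis V j) +
      conj (α (Complex.I • unitaryBasis V j)) * β (Complex.I • unitaryBasis V j)) := by
  rw [covectorInner, ← toLex.sum_comp, Fintype.sum_prod_type]
  simp only [Fin.sum_univ_two, realBasis_zero, realBasis_one]

theorem covectorInner_rot_rot (α β : Covector V) :
    covectorInner (rot α) (rot β) = covectorInner α β := by
  rw [covectorInner_eq_sum, covectorInner_eq_sum]
  refine Finset.sum_congr rfl fun j _ => ?_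
  simp only [rot_apply, smul_smul, Complex.I_mul_I, neg_smul, one_smul, map_neg]
  ring

theorem covectorInner_add_left (α β γ : Covector V) :
    covectorInner (α + β) γ = covectorInner α γ + covectorInner β γ := by
  simp [covectorInner, add_mul, Finset.sum_add_distrib]

theorem covectorInner_smul_left (c : ℂ) (α β : Covector V) :
    covectorInner (c • α) β = conj c * covectorInner α β := by
  simp [covectorInner, Finset.mul_sum, mul_assoc]

theorem covectorInner_add_right (α β γ : Covector V) :
    covectorInner α (β + γ) = covectorInner α β + covectorInner α γ :=
  (flat α).map_add β γ

theorem covectorInner_smul_right (c : ℂ) (α β : Covector V) :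
    covectorInner α (c • β) = c * covectorInner α β :=
  (flat α).map_smul c β

theorem covectorInner_neg_right (α β : Covector V) :
    covectorInner α (-β) = -covectorInner α β :=
  (flat α).map_neg β

theorem covectorInner_rot_left (α β : Covector V) :
    covectorInner (rot α) β = -covectorInner α (rot β) := by
  rw [← covectorInner_rot_rot α, rot_rot, covectorInner_neg_right, neg_neg]

/-- Since `rot` is skew-adjoint, `i rot` is self-adjoint; real `a` and `b` keep the combination
self-adjoint. -/
theorem covectorInner_typeScale (a b : ℝ) (α β : Covector V) :
    covectorInner (typeScale (a : ℂ) b α) β = covectorInner α (typeScale (a : ℂ) b β) := by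
  simp only [typeScale_apply, sub_eq_add_neg, ← neg_smul, covectorInner_add_left,
    covectorInner_smul_left, covectorInner_add_right, covectorInner_smul_right,
    covectorInner_rot_left]
  simp [Complex.conj_ofNat]

theorem inner_map_typeScale (a b : ℝ) (x y : Forms V) :
    inner ℂ (ExteriorAlgebra.map (typeScale (a : ℂ) b) x) y =
      inner ℂ x (ExteriorAlgebra.map (typeScale (a : ℂ) b) y) := by
  refine forms_induction (P := fun x => inner ℂ (ExteriorAlgebra.map (typeScale (a : ℂ) b) x) y =
    inner ℂ x (ExteriorAlgebra.map (typeScale (a : ℂ) b) y))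
    (by simp) (fun x z hx hz => ?_) (fun c x hx => ?_) (fun j u => ?_) x
  · simp only [map_add, inner_add_left, hx, hz]
  · simp only [map_smul, inner_smul_left, hx]
  refine forms_induction (P := fun y => inner ℂ (ExteriorAlgebra.map (typeScale (a : ℂ) b)
    (ιMulti ℂ j u)) y = inner ℂ (ιMulti ℂ j u) (ExteriorAlgebra.map (typeScale (a : ℂ) b) y))
    (by simp) (fun x z hx hz => ?_) (fun c x hx => ?_) (fun k v => ?_) y
  · simp only [map_add, inner_add_right, hx, hz]
  · simp only [map_smul, inner_smul_right, hx]
  rw [ExteriorAlgebra.map_apply_ιMulti, ExteriorAlgebra.map_apply_ιMulti]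
  by_cases hjk : j = k
  · subst hjk
    rw [inner_ιMulti, inner_ιMulti]
    simp only [Function.comp_apply, covectorInner_typeScale]
  · rw [inner_eq_zero_of_degree_ne hjk (ιMulti_mem_degree _) (ιMulti_mem_degree _),
      inner_eq_zero_of_degree_ne hjk (ιMulti_mem_degree _) (ιMulti_mem_degree _)]

/-- Forms of different types are orthogonal. -/
theorem inner_eq_zero_of_type_ne {p q p' q' : ℕ} (h : (p, q) ≠ (p', q')) {x y : Forms V}
    (hx : x ∈ formsPQ V p q) (hy : y ∈ formsPQ V p' q') : inner ℂ x y = 0 := by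
  -- Eigenvectors of a self-adjoint operator with different real eigenvalues are orthogonal. The
  -- scalings `(1, 2)` and `(2, 1)` separate different `q` and different `p`.
  have key : ∀ a b : ℝ, a ^ p * b ^ q ≠ a ^ p' * b ^ q' → inner ℂ x y = 0 := by
    intro a b hab
    have h1 := inner_map_typeScale a b x y
    rw [map_apply_of_mem_formsPQ _ a b (fun _ h => typeScale_hol _ _ h)
      (fun _ h => typeScale_antihol _ _ h) hx, map_apply_of_mem_formsPQ _ a b
      (fun _ h => typeScale_hol _ _ h) (fun _ h => typeScale_antihol _ _ h) hy,
      inner_smul_left, inner_smul_right] at h1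
    simp only [map_mul, map_pow, Complex.conj_ofReal] at h1
    by_contra hne
    exact hab (by exact_mod_cast mul_right_cancel₀ hne h1)
  by_cases hp : p = p'
  · refine key 1 2 fun h2 => h ?_
    exact Prod.ext hp (pow_right_injective₀ (a := (2 : ℝ)) (by norm_num) (by norm_num)
      (by simpa using h2))
  · refine key 2 1 fun h2 => hp ?_
    exact pow_right_injective₀ (a := (2 : ℝ)) (by norm_num) (by norm_num) (by simpa using h2)

/-- This power is the image of `⋀^p M`, whose dimension is the binomial coefficient `dim M` over
`p`. -/
theorem pow_map_ι_eq_bot {M : Submodule ℂ (Covector V)} {p : ℕ} (hp : finrank ℂ M < p) :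
    (M.map (ι ℂ : _ →ₗ[ℂ] Forms V)) ^ p = ⊥ := by
  have h : M.map (ι ℂ : _ →ₗ[ℂ] Forms V) =
      (LinearMap.range (ι ℂ)).map (ExteriorAlgebra.map M.subtype).toLinearMap := by
    rw [ExteriorAlgebra.ι_range_map_map, Submodule.range_subtype]
  have : FiniteDimensional ℂ (Covector V) := (coframe V).finiteDimensional_of_finite
  have h0 : (LinearMap.range (ι ℂ : M →ₗ[ℂ] ExteriorAlgebra ℂ M)) ^ p = ⊥ := by
    change ⋀[ℂ]^p M = ⊥
    rw [← Submodule.finrank_eq_zero, exteriorPower.finrank_eq, Nat.choose_eq_zero_of_lt hp]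
  rw [h, ← Submodule.map_pow, h0, Submodule.map_bot]

/-- Under `hM`, the values on the unitary basis determine a covector in `M`, so `M` embeds in `ℂ^n`.
-/
theorem finrank_covectors_le {M : Submodule ℂ (Covector V)}
    (hM : ∀ α ∈ M, ∀ v, α v = 0 → α (Complex.I • v) = 0) : finrank ℂ M ≤ finrank ℂ V := by
  have : FiniteDimensional ℂ (Covector V) := (coframe V).finiteDimensional_of_finite
  let f : Covector V →ₗ[ℂ] (Fin (finrank ℂ V) → ℂ) :=
    { toFun := fun α j => α (unitaryBasis V j)
      map_add' := fun _ _ => rfl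
      map_smul' := fun _ _ => rfl }
  have hf : Function.Injective (f.comp M.subtype) := by
    rw [← LinearMap.ker_eq_bot, LinearMap.ker_eq_bot']
    rintro ⟨α, hα⟩ h
    have h0 : ∀ j, α (unitaryBasis V j) = 0 := fun j => congrFun h j
    refine Subtype.ext ((realBasis V).ext fun i => ?_)
    obtain ⟨⟨j, a⟩, rfl⟩ := toLex.surjective i
    fin_cases a
    · exact (congrArg α (realBasis_zero V j)).trans (h0 j)
    · exact (congrArg α (realBasis_one V j)).trans (hM α hα _ (h0 j))
  simpa using LinearMap.finrank_le_finrank_of_injective hf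

/-- Shows that the finite range of types in `weilOp` omits nothing. -/
theorem formsPQ_eq_bot {p q : ℕ} (h : finrank ℂ V < p ∨ finrank ℂ V < q) :
    formsPQ V p q = ⊥ := by
  rcases h with h | h
  · rw [formsPQ, pow_map_ι_eq_bot, Submodule.bot_mul]
    refine (finrank_covectors_le fun α hα v hv => ?_).trans_lt h
    rw [hα v, hv, mul_zero]
  · rw [formsPQ, pow_map_ι_eq_bot (M := antiholCovectors V), Submodule.mul_bot]
    refine (finrank_covectors_le fun α hα v hv => ?_).trans_lt h
    rw [hα v, hv, mul_zero, neg_zero]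

/-- The operator `𝐈` is the multiplicative extension of `α ↦ α (i ·)`. -/
theorem weilOp_eq_map_rot (x : Forms V) : weilOp V x = ExteriorAlgebra.map rot x := by
  refine formsPQ_induction (P := fun x => weilOp V x = ExteriorAlgebra.map rot x)
    (fun x y hx hy => by rw [map_add, map_add, hx, hy]) (fun p q x hx => ?_) x
  -- On type `(p,q)` the extension of `rot` is the scalar `i^p (-i)^q = i^(p-q)`.
  rw [map_apply_of_mem_formsPQ rot Complex.I (-Complex.I)
    (fun α hα => mem_holCovectors_iff.mp hα)
    (fun α hα => by rw [mem_antiholCovectors_iff.mp hα, neg_smul]) hx]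
  by_cases hpq : finrank ℂ V < p ∨ finrank ℂ V < q
  · rw [formsPQ_eq_bot hpq, Submodule.mem_bot] at hx
    rw [hx, map_zero, smul_zero]
  push Not at hpq
  have hproj : ∀ p' q', projPQ V p' q' x = if p' = p ∧ q' = q then x else 0 := by
    intro p' q'
    split_ifs with h
    · obtain ⟨rfl, rfl⟩ := h
      exact Submodule.starProjection_eq_self_iff.mpr hx
    · refine (Submodule.starProjection_apply_eq_zero_iff _).mpr fun y hy => ?_
      exact inner_eq_zero_of_type_ne (fun h' => h (by simpa using h')) hy hx
  simp only [weilOp, LinearMap.sum_apply, LinearMap.smul_apply, hproj]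
  rw [Finset.sum_eq_single_of_mem p (Finset.mem_range.mpr (by omega)),
    Finset.sum_eq_single_of_mem q (Finset.mem_range.mpr (by omega))]
  · rw [if_pos ⟨rfl, rfl⟩, zpow_sub₀ Complex.I_ne_zero, zpow_natCast, zpow_natCast, div_eq_mul_inv,
      ← inv_pow, Complex.inv_I]
  · intro q' _ hq
    rw [if_neg fun h => hq h.2, smul_zero]
  · intro p' _ hp
    refine Finset.sum_eq_zero fun q' _ => ?_
    rw [if_neg fun h => hp h.1, smul_zero]

/-! ### The antilinear operator `x ↦ conj (𝐈 x)` -/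

/-- The operator `x ↦ conj (𝐈 x)`. -/
def conjWeil : Forms V →ₛₗ[starRingEnd ℂ] Forms V := (conjForm V).comp (weilOp V)

theorem covectorInner_conjRot (α β : Covector V) :
    covectorInner (conjRot α) (conjRot β) = covectorInner β α := by
  have h : ∀ α β : Covector V,
      covectorInner (conjCovector α) (conjCovector β) = covectorInner β α := by
    intro α β
    simp [covectorInner, conjCovector, mul_comm]
  rw [conjRot, conjRot, h, covectorInner_rot_rot]

theorem conjWeil_apply (x : Forms V) : conjForm V (weilOp V x) = conjWeil x := rfl

theorem conjWeil_ι (α : Covector V) : conjWeil (ι ℂ α) = ι ℂ (conjRot α) := by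
  rw [← conjWeil_apply, weilOp_eq_map_rot, ExteriorAlgebra.map_apply_ι, conjForm_ι, conjRot]

theorem conjWeil_one : conjWeil (1 : Forms V) = 1 := by
  rw [← conjWeil_apply, weilOp_eq_map_rot, map_one, conjForm_one]

theorem conjWeil_mul (x y : Forms V) : conjWeil (x * y) = conjWeil x * conjWeil y := by
  simp only [← conjWeil_apply, weilOp_eq_map_rot, map_mul, conjForm_mul]

theorem conjWeil_pow (x : Forms V) (m : ℕ) : conjWeil (x ^ m) = conjWeil x ^ m := by
  induction m with
  | zero => rw [pow_zero, pow_zero, conjWeil_one]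
  | succ m ih => rw [pow_succ, pow_succ, conjWeil_mul, ih]

theorem conjWeil_ιMulti {k : ℕ} (a : Fin k → Covector V) :
    conjWeil (ιMulti ℂ k a) = ιMulti ℂ k fun i => conjRot (a i) := by
  induction k with
  | zero => simp only [ExteriorAlgebra.ιMulti_zero_apply, conjWeil_one]
  | succ k ih => rw [ιMulti_succ_eq, ιMulti_succ_eq, conjWeil_mul, conjWeil_ι, ih]

theorem conjWeil_mem_degree {k : ℕ} {x : Forms V} (hx : x ∈ ⋀[ℂ]^k (Covector V)) :
    conjWeil x ∈ ⋀[ℂ]^k (Covector V) := by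
  refine forms_degree_induction (P := fun x => conjWeil x ∈ ⋀[ℂ]^k (Covector V))
    (by simp) (fun x y hx hy => ?_) (fun c x hx => ?_) (fun a => ?_) hx
  · rw [map_add]; exact add_mem hx hy
  · rw [map_smulₛₗ]; exact Submodule.smul_mem _ _ hx
  · rw [conjWeil_ιMulti]; exact ιMulti_mem_degree _

/-- Antiunitarity: `conjRot` swaps the arguments of `covectorInner`, which transposes the Gram
matrix and preserves its determinant. -/
theorem inner_conjWeil (x y : Forms V) : inner ℂ (conjWeil x) (conjWeil y) = inner ℂ y x := by
  refine forms_induction (P := fun x => inner ℂ (conjWeil x) (conjWeil y) = inner ℂ y x)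
    (by simp) (fun x z hx hz => ?_) (fun c x hx => ?_) (fun j u => ?_) x
  · simp only [map_add, inner_add_left, inner_add_right, hx, hz]
  · simp only [map_smulₛₗ, inner_smul_left, inner_smul_right, hx, Complex.conj_conj]
  refine forms_induction (P := fun y => inner ℂ (conjWeil (ιMulti ℂ j u)) (conjWeil y) =
    inner ℂ y (ιMulti ℂ j u))
    (by simp) (fun x z hx hz => ?_) (fun c x hx => ?_) (fun k v => ?_) y
  · simp only [map_add, inner_add_left, inner_add_right, hx, hz]
  · simp only [map_smulₛₗ, inner_smul_left, inner_smul_right, hx]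
  rw [conjWeil_ιMulti, conjWeil_ιMulti]
  by_cases hjk : j = k
  · subst hjk
    rw [inner_ιMulti, inner_ιMulti, ← Matrix.det_transpose]
    simp only [covectorInner_conjRot]
    rfl
  · rw [inner_eq_zero_of_degree_ne hjk (ιMulti_mem_degree _) (ιMulti_mem_degree _),
      inner_eq_zero_of_degree_ne (Ne.symm hjk) (ιMulti_mem_degree _) (ιMulti_mem_degree _)]

theorem conjWeil_surjective : Function.Surjective (conjWeil (V := V)) := by
  have h : ∀ x : Forms V, ∃ y, conjWeil y = x := by
    intro x
    refine forms_induction (P := fun x => ∃ y, conjWeil y = x) ⟨0, map_zero _⟩ ?_ ?_ ?_ x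
    · rintro _ _ ⟨x, rfl⟩ ⟨y, rfl⟩
      exact ⟨x + y, map_add _ _ _⟩
    · rintro c _ ⟨x, rfl⟩
      exact ⟨conj c • x, by rw [map_smulₛₗ, Complex.conj_conj]⟩
    · intro k a
      -- The inverse of `conjRot` is `-conjRot`, because its square is `-1`.
      refine ⟨ιMulti ℂ k fun i => -conjRot (a i), ?_⟩
      rw [conjWeil_ιMulti]
      congr 1
      ext i v
      simp [conjRot, conjCovector, rot_apply, smul_smul]
  exact h

theorem conjRot_coframe_zero (j : Fin (finrank ℂ V)) :
    conjRot (coframe V (toLex (j, 0))) = -coframe V (toLex (j, 1)) := by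
  refine (realBasis V).ext fun i => ?_
  obtain ⟨⟨k, a⟩, rfl⟩ := toLex.surjective i
  have h0 := coframe_apply_realBasis V (toLex (j, 0)) (toLex (k, 0))
  have h1 := coframe_apply_realBasis V (toLex (j, 0)) (toLex (k, 1))
  rw [realBasis_zero] at h0
  rw [realBasis_one] at h1
  rw [LinearMap.neg_apply, coframe_apply_realBasis]
  fin_cases a <;>
  simp [realBasis_zero, realBasis_one, conjRot, conjCovector, rot_apply, smul_smul, h0, h1]

theorem conjRot_coframe_one (j : Fin (finrank ℂ V)) :
    conjRot (coframe V (toLex (j, 1))) = coframe V (toLex (j, 0)) := by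
  have h : ∀ α : Covector V, conjRot (-α) = -conjRot α := fun α => by
    ext v
    simp [conjRot, conjCovector, rot_apply]
  rw [← neg_neg (coframe V (toLex (j, 1))), ← conjRot_coframe_zero, h, conjRot_conjRot, neg_neg]

theorem conjWeil_omega : conjWeil (omega V) = omega V := by
  rw [omega, map_sum]
  refine Finset.sum_congr rfl fun j _ => ?_
  rw [conjWeil_mul, conjWeil_ι, conjWeil_ι, conjRot_coframe_zero, conjRot_coframe_one, map_neg,
    neg_mul, ι_mul_ι_comm, neg_neg]

end Types

/-! ### Commutation relations of the Lefschetz operators -/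

section Lefschetz

theorem divPow_zero {A : Type*} [Ring A] [Algebra ℂ A] (a : A) : divPow a 0 = 1 := by
  simp [divPow]

theorem succ_smul_divPow_succ {A : Type*} [Ring A] [Algebra ℂ A] (a : A) (m : ℕ) :
    ((m : ℂ) + 1) • divPow a (m + 1) = a * divPow a m := by
  have h : ((m : ℂ) + 1) ≠ 0 := by exact_mod_cast m.succ_ne_zero
  rw [divPow, divPow, mul_smul_comm, ← pow_succ', smul_smul, Nat.factorial_succ]
  push_cast
  rw [mul_inv, mul_inv_cancel_left₀ h]

theorem divPow_mul_divPow {A : Type*} [Ring A] [Algebra ℂ A] (a : A) (m l : ℕ) :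
    divPow a m * divPow a l = ((m + l).choose l : ℂ) • divPow a (m + l) := by
  have hm : (m ! : ℂ) ≠ 0 := by exact_mod_cast m.factorial_ne_zero
  have hl : (l ! : ℂ) ≠ 0 := by exact_mod_cast l.factorial_ne_zero
  have hml : ((m + l) ! : ℂ) ≠ 0 := by exact_mod_cast (m + l).factorial_ne_zero
  have h : ((m + l).choose l : ℂ) * (m ! * l !) = ((m + l) ! : ℂ) := by
    rw [← mul_assoc]
    exact_mod_cast Nat.add_choose_mul_factorial_mul_factorial m l
  rw [divPow, divPow, divPow, smul_mul_smul_comm, ← pow_add, smul_smul]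
  congr 1
  field_simp
  linear_combination -h

variable {V : Type*} [NormedAddCommGroup V] [InnerProductSpace ℂ V] [FiniteDimensional ℂ V]

theorem omega_mul_comm (x : Forms V) : omega V * x = x * omega V := by
  induction x using CliffordAlgebra.left_induction with
  | algebraMap r => exact (Algebra.commutes r (omega V)).symm
  | add x y hx hy => rw [mul_add, add_mul, hx, hy]
  | ι_mul x α hx =>
    change omega V * (ι ℂ α * x) = ι ℂ α * x * omega V
    have h : omega V * ι ℂ α = ι ℂ α * omega V := by
      rw [omega, Finset.sum_mul, Finset.mul_sum]
      refine Finset.sum_congr rfl fun j _ => ?_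
      rw [mul_assoc, ι_mul_ι_comm _ α, mul_neg, ← mul_assoc, ι_mul_ι_comm _ α, neg_mul, neg_neg,
        mul_assoc]
    rw [← mul_assoc, h, mul_assoc, hx, mul_assoc]

/-- The coefficients are written as inner products with `α` because these are the numbers produced
by contracting `ω`. -/
theorem conjRot_eq_sum (α : Covector V) :
    conjRot α = ∑ j, (covectorInner α (coframe V (toLex (j, 1))) • coframe V (toLex (j, 0)) -
      covectorInner α (coframe V (toLex (j, 0))) • coframe V (toLex (j, 1))) := by
  have h : ∀ i, covectorInner α (coframe V i) = conj (α (realBasis V i)) := fun i => by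
    simp [covectorInner, coframe_apply_realBasis]
  conv_lhs => rw [← (coframe V).sum_repr (conjRot α)]
  rw [← toLex.sum_comp, Fintype.sum_prod_type]
  refine Finset.sum_congr rfl fun j _ => ?_
  simp only [Fin.sum_univ_two, h, coframe_repr, realBasis_zero, realBasis_one, conjRot,
    conjCovector, rot_apply, LinearMap.coe_mk, AddHom.coe_mk, smul_smul, Complex.I_mul_I,
    neg_smul, one_smul, map_neg, sub_eq_add_neg]

/-- The contraction of `ω` itself is `-Jα`, and `ω` has even degree. Taking adjoints in `[i_α, L] =
-Jα ∧` gives `lefschetzAdjoint_ι_mul`. -/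
theorem interior_omega_mul (α : Covector V) (x : Forms V) :
    interior α (omega V * x) = omega V * interior α x - ι ℂ (conjRot α) * x := by
  rw [conjRot_eq_sum, map_sum, omega, Finset.sum_mul, map_sum, Finset.sum_mul, Finset.sum_mul,
    ← Finset.sum_sub_distrib]
  refine Finset.sum_congr rfl fun j _ => ?_
  rw [mul_assoc, interior_ι_mul, interior_ι_mul, map_sub, map_smul, map_smul, mul_sub, sub_mul,
    mul_smul_comm, smul_mul_assoc, smul_mul_assoc, mul_assoc]
  abel

theorem interior_neg (α : Covector V) (x : Forms V) : interior (-α) x = -interior α x := by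
  refine ext_inner_left ℂ fun y => ?_
  rw [← inner_ι_mul_left, inner_neg_right, ← inner_ι_mul_left, map_neg, neg_mul, inner_neg_left]

/-- The truncated exponent `m - 1` is harmless at `m = 0`, where the coefficient vanishes. -/
theorem interior_omega_pow (α : Covector V) (m : ℕ) :
    interior α (omega V ^ m) = -((m : ℂ) • (ι ℂ (conjRot α) * omega V ^ (m - 1))) := by
  induction m with
  | zero => simp [interior_one]
  | succ m ih =>
    rw [pow_succ', interior_omega_mul, ih]
    cases m with
    | zero => simp
    | succ m =>
      rw [mul_neg, mul_smul_comm, ← mul_assoc, omega_mul_comm (ι ℂ (conjRot α)), mul_assoc,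
        ← pow_succ']
      simp only [Nat.add_sub_cancel]
      push_cast
      module

theorem inner_lefschetzAdjoint_left (x y : Forms V) :
    inner ℂ (lefschetzAdjoint V x) y = inner ℂ x (omega V * y) :=
  LinearMap.adjoint_inner_left (lefschetz V) y x

theorem lefschetzAdjoint_ι_mul (α : Covector V) (x : Forms V) :
    lefschetzAdjoint V (ι ℂ α * x) =
      ι ℂ α * lefschetzAdjoint V x - interior (conjRot α) x := by
  refine ext_inner_right ℂ fun y => ?_
  rw [inner_lefschetzAdjoint_left, inner_ι_mul_left, interior_omega_mul, inner_sub_right,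
    inner_sub_left, inner_ι_mul_left, inner_lefschetzAdjoint_left, inner_ι_mul_right]

/-- The adjoint of the fact that `ω` commutes with `α`. -/
theorem interior_lefschetzAdjoint (α : Covector V) (x : Forms V) :
    interior α (lefschetzAdjoint V x) = lefschetzAdjoint V (interior α x) := by
  refine ext_inner_right ℂ fun y => ?_
  rw [inner_lefschetzAdjoint_left, ← inner_ι_mul_right, ← inner_ι_mul_right,
    inner_lefschetzAdjoint_left, ← mul_assoc, ← mul_assoc, omega_mul_comm]

theorem lefschetzAdjoint_one : lefschetzAdjoint V 1 = 0 := by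
  refine ext_inner_right ℂ fun y => ?_
  rw [inner_lefschetzAdjoint_left, inner_zero_left, omega, Finset.sum_mul, inner_sum]
  refine Finset.sum_eq_zero fun j _ => ?_
  rw [mul_assoc, inner_ι_mul_right, interior_one, inner_zero_left]

/-- This is `[Λ, L] = n - degree`, with the degree operator written as the sum of `α ∧ i_α` over the
coframe. -/
theorem lefschetzAdjoint_omega_mul (x : Forms V) :
    lefschetzAdjoint V (omega V * x) = omega V * lefschetzAdjoint V x +
      ∑ j, (x - ι ℂ (coframe V (toLex (j, 0))) * interior (coframe V (toLex (j, 0))) x -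
        ι ℂ (coframe V (toLex (j, 1))) * interior (coframe V (toLex (j, 1))) x) := by
  rw [omega, Finset.sum_mul, Finset.sum_mul, map_sum, ← Finset.sum_add_distrib]
  refine Finset.sum_congr rfl fun j _ => ?_
  have h : covectorInner (coframe V (toLex (j, 1))) (coframe V (toLex (j, 1))) = 1 := by
    simp [covectorInner, coframe_apply_realBasis]
  rw [mul_assoc, lefschetzAdjoint_ι_mul, lefschetzAdjoint_ι_mul, conjRot_coframe_zero,
    conjRot_coframe_one, interior_neg, interior_ι_mul, h, one_smul, mul_sub, mul_assoc]
  abel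

/-- Each commutation of `Λ` past a factor `ω` contributes `n - 2i`, and `∑_{i ≤ m} (n - 2i) = (m +
1)(n - m)`. -/
theorem lefschetzAdjoint_omega_pow_succ (m : ℕ) :
    lefschetzAdjoint V (omega V ^ (m + 1)) =
      (((m : ℂ) + 1) * ((finrank ℂ V : ℂ) - m)) • omega V ^ m := by
  have hdeg : ∀ m : ℕ, ∑ j, (omega V ^ m - ι ℂ (coframe V (toLex (j, 0))) *
      interior (coframe V (toLex (j, 0))) (omega V ^ m) -
        ι ℂ (coframe V (toLex (j, 1))) * interior (coframe V (toLex (j, 1))) (omega V ^ m)) =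
      ((finrank ℂ V : ℂ) - 2 * m) • omega V ^ m := by
    intro m
    have h : ∀ j, ι ℂ (coframe V (toLex (j, 0))) *
      interior (coframe V (toLex (j, 0))) (omega V ^ m) +
        ι ℂ (coframe V (toLex (j, 1))) * interior (coframe V (toLex (j, 1))) (omega V ^ m) =
        (2 * m : ℂ) • (ι ℂ (coframe V (toLex (j, 0))) * ι ℂ (coframe V (toLex (j, 1))) *
          omega V ^ (m - 1)) := by
      intro j
      rw [interior_omega_pow, interior_omega_pow, conjRot_coframe_zero, conjRot_coframe_one,
        map_neg, neg_mul, smul_neg, neg_neg, mul_neg, mul_smul_comm, mul_smul_comm, ← mul_assoc,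
        ← mul_assoc, ι_mul_ι_comm (coframe V (toLex (j, 1))), neg_mul]
      module
    simp only [sub_sub, h]
    rw [Finset.sum_sub_distrib, ← Finset.smul_sum, ← Finset.sum_mul, ← omega]
    simp only [Finset.sum_const, Finset.card_univ, Fintype.card_fin]
    cases m with
    | zero => simp [Nat.cast_smul_eq_nsmul]
    | succ m =>
      rw [Nat.add_sub_cancel, ← pow_succ', sub_smul, Nat.cast_smul_eq_nsmul]
  induction m with
  | zero =>
    have h := hdeg 0
    rw [pow_zero] at h
    rw [pow_succ', pow_zero, lefschetzAdjoint_omega_mul, lefschetzAdjoint_one, mul_zero, zero_add, h]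
    simp
  | succ m ih =>
    rw [pow_succ', lefschetzAdjoint_omega_mul, ih, hdeg, mul_smul_comm, ← pow_succ', ← add_smul]
    congr 1
    push_cast
    ring

/-! ### Divided powers of `Λ`: commutation, degrees and vanishing. -/

/-- The operators `Λ ^ m / m!`. -/
abbrev lefschetzAdjointPow (V : Type*) [NormedAddCommGroup V] [InnerProductSpace ℂ V]
    [FiniteDimensional ℂ V] (m : ℕ) : Forms V →ₗ[ℂ] Forms V :=
  divPow (lefschetzAdjoint V) m

theorem lefschetzAdjointPow_zero (x : Forms V) : lefschetzAdjointPow V 0 x = x := by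
  rw [lefschetzAdjointPow, divPow_zero, Module.End.one_apply]

theorem succ_smul_lefschetzAdjointPow_succ (m : ℕ) (x : Forms V) :
    ((m : ℂ) + 1) • lefschetzAdjointPow V (m + 1) x =
      lefschetzAdjoint V (lefschetzAdjointPow V m x) :=
  LinearMap.congr_fun (succ_smul_divPow_succ (lefschetzAdjoint V) m) x

theorem lefschetzAdjointPow_succ (m : ℕ) (x : Forms V) :
    lefschetzAdjointPow V (m + 1) x =
      ((m : ℂ) + 1)⁻¹ • lefschetzAdjoint V (lefschetzAdjointPow V m x) := by
  have h : ((m : ℂ) + 1) ≠ 0 := by exact_mod_cast m.succ_ne_zero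
  rw [← succ_smul_lefschetzAdjointPow_succ, smul_smul, inv_mul_cancel₀ h, one_smul]

theorem lefschetzAdjointPow_lefschetzAdjointPow (m l : ℕ) (x : Forms V) :
    lefschetzAdjointPow V m (lefschetzAdjointPow V l x) =
      ((m + l).choose l : ℂ) • lefschetzAdjointPow V (m + l) x :=
  LinearMap.congr_fun (divPow_mul_divPow (lefschetzAdjoint V) m l) x

theorem inner_lefschetzAdjointPow_left (m : ℕ) (x y : Forms V) :
    inner ℂ (lefschetzAdjointPow V m x) y = inner ℂ x (divPow (omega V) m * y) := by
  induction m generalizing y with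
  | zero => rw [lefschetzAdjointPow_zero, divPow_zero, one_mul]
  | succ m ih =>
    have h : ((m : ℂ) + 1) ≠ 0 := by exact_mod_cast m.succ_ne_zero
    have h1 := succ_smul_divPow_succ (omega V) m
    rw [lefschetzAdjointPow_succ, inner_smul_left, inner_lefschetzAdjoint_left, ih, ← mul_assoc,
      ← omega_mul_comm, ← h1, smul_mul_assoc, inner_smul_right, ← mul_assoc]
    simp [h]

theorem inner_lefschetzAdjointPow_right (m : ℕ) (x y : Forms V) :
    inner ℂ x (lefschetzAdjointPow V m y) = inner ℂ (divPow (omega V) m * x) y := by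
  rw [← inner_conj_symm, inner_lefschetzAdjointPow_left, inner_conj_symm]

/-- The commutator `[Λ, α ∧] = -i_{Jα}` commutes with `Λ`, so commuting `α ∧` with `Λ^[m+1]` acts
like differentiating a divided power. -/
theorem lefschetzAdjointPow_ι_mul (m : ℕ) (α : Covector V) (x : Forms V) :
    lefschetzAdjointPow V (m + 1) (ι ℂ α * x) =
      ι ℂ α * lefschetzAdjointPow V (m + 1) x -
        interior (conjRot α) (lefschetzAdjointPow V m x) := by
  induction m with
  | zero =>
    simp only [lefschetzAdjointPow_succ, lefschetzAdjointPow_zero, lefschetzAdjoint_ι_mul]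
    simp
  | succ m ih =>
    have h : ((m : ℂ) + 1 + 1) ≠ 0 := by exact_mod_cast (m + 1).succ_ne_zero
    rw [lefschetzAdjointPow_succ, ih, map_sub, lefschetzAdjoint_ι_mul,
      ← interior_lefschetzAdjoint, ← succ_smul_lefschetzAdjointPow_succ m, map_smul,
      ← succ_smul_lefschetzAdjointPow_succ (m + 1), mul_smul_comm, smul_sub, smul_sub,
      smul_smul, smul_smul]
    push_cast
    rw [inv_mul_cancel₀ h, one_smul, sub_sub, ← add_smul]
    congr 1
    refine (congrArg (· • _) ?_).trans (one_smul ℂ _)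
    field_simp
    ring

theorem divPow_omega_mem_degree (m : ℕ) : divPow (omega V) m ∈ ⋀[ℂ]^(2 * m) (Covector V) := by
  refine Submodule.smul_mem _ _ ?_
  have h : omega V ∈ ⋀[ℂ]^2 (Covector V) :=
    Submodule.sum_mem _ fun j _ => mul_mem_degree (ι_mem_degree_one _) (ι_mem_degree_one _)
  rw [ExteriorAlgebra.exteriorPower, pow_mul]
  exact Submodule.pow_mem_pow _ h m

theorem divPow_omega_eq_zero {m : ℕ} (hm : finrank ℂ V < m) : divPow (omega V) m = 0 :=
  degree_eq_zero (by omega) (divPow_omega_mem_degree m)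

theorem lefschetzAdjointPow_eq_zero {m : ℕ} (hm : finrank ℂ V < m) (x : Forms V) :
    lefschetzAdjointPow V m x = 0 := by
  refine ext_inner_right ℂ fun y => ?_
  rw [inner_lefschetzAdjointPow_left, divPow_omega_eq_zero hm, zero_mul, inner_zero_right,
    inner_zero_left]

/-- Lets degree statements about `Λ` be read off by adjunction from those about `ω`. -/
theorem mem_degree_of_inner {k : ℕ} {x : Forms V}
    (h : ∀ j ≠ k, ∀ y ∈ ⋀[ℂ]^j (Covector V), inner ℂ y x = 0) : x ∈ ⋀[ℂ]^k (Covector V) := by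
  rw [← (formBasis V).sum_repr x]
  refine Submodule.sum_mem _ fun s _ => ?_
  by_cases hs : s.card = k
  · exact Submodule.smul_mem _ _ (hs ▸ formBasis_mem_degree s)
  · have h1 := h _ hs _ (formBasis_mem_degree s)
    have h2 : (formBasis V).repr x s = 0 := by
      rw [← h1, inner_def]
      simp [Finsupp.single_apply]
    rw [h2, zero_smul]
    exact zero_mem _

theorem lefschetzAdjointPow_mem_degree {k m : ℕ} {x : Forms V}
    (hx : x ∈ ⋀[ℂ]^(2 * m + k) (Covector V)) :
    lefschetzAdjointPow V m x ∈ ⋀[ℂ]^k (Covector V) := by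
  refine mem_degree_of_inner fun j hj y hy => ?_
  rw [inner_lefschetzAdjointPow_right]
  exact inner_eq_zero_of_degree_ne (by omega) (mul_mem_degree (divPow_omega_mem_degree m) hy) hx

theorem lefschetzAdjointPow_eq_zero_of_degree {k m : ℕ} (hkm : k < 2 * m) {x : Forms V}
    (hx : x ∈ ⋀[ℂ]^k (Covector V)) : lefschetzAdjointPow V m x = 0 := by
  rw [← inner_self_eq_zero (𝕜 := ℂ), inner_lefschetzAdjointPow_left]
  -- Any degree would do in place of `0`: what counts is that the norm squared pairs `x` with a form
  -- of degree at least `2 * m`.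
  have h : lefschetzAdjointPow V m x ∈ ⋀[ℂ]^0 (Covector V) := by
    refine mem_degree_of_inner fun j hj y hy => ?_
    rw [inner_lefschetzAdjointPow_right]
    exact inner_eq_zero_of_degree_ne (by omega) (mul_mem_degree (divPow_omega_mem_degree m) hy) hx
  exact inner_eq_zero_of_degree_ne (by omega) hx (mul_mem_degree (divPow_omega_mem_degree m) h)

/-- An antiunitary multiplicative map fixing `ω` commutes with `L`, hence with its adjoint. -/
theorem conjWeil_lefschetzAdjointPow (m : ℕ) (x : Forms V) :
    conjWeil (lefschetzAdjointPow V m x) = lefschetzAdjointPow V m (conjWeil x) := by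
  refine ext_inner_right ℂ fun z => ?_
  obtain ⟨y, rfl⟩ := conjWeil_surjective z
  have h : conjWeil (divPow (omega V) m) = divPow (omega V) m := by
    rw [divPow, map_smulₛₗ, conjWeil_pow, conjWeil_omega]
    simp
  rw [inner_conjWeil, inner_lefschetzAdjointPow_left, inner_lefschetzAdjointPow_right,
    ← inner_conjWeil, conjWeil_mul, h]

/-! ### The volume form -/

theorem inner_one_one : inner ℂ (1 : Forms V) 1 = 1 := by
  have h := inner_ιMulti V (k := 0) ![] ![]
  rwa [ExteriorAlgebra.ιMulti_zero_apply, Matrix.det_fin_zero] at h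

/-- One has `Λ ω^[j+1] = (n - j) ω^[j]`, and at step `m + 1` the factor `n - j = m + 1` cancels the
division in the divided power. -/
theorem lefschetzAdjointPow_volume {m j : ℕ} (h : m + j = finrank ℂ V) :
    lefschetzAdjointPow V m (divPow (omega V) (finrank ℂ V)) = divPow (omega V) j := by
  induction m generalizing j with
  | zero => rw [lefschetzAdjointPow_zero, ← h, zero_add]
  | succ m ih =>
    have hm : ((m : ℂ) + 1) ≠ 0 := by exact_mod_cast m.succ_ne_zero
    have hj : ((j : ℂ) + 1) ≠ 0 := by exact_mod_cast j.succ_ne_zero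
    have hn : (finrank ℂ V : ℂ) = m + 1 + j := by rw [← h]; push_cast; ring
    rw [lefschetzAdjointPow_succ, ih (j := j + 1) (by omega), divPow, map_smul,
      lefschetzAdjoint_omega_pow_succ, divPow, smul_smul, smul_smul, hn, Nat.factorial_succ]
    congr 1
    push_cast
    have : (j ! : ℂ) ≠ 0 := by exact_mod_cast j.factorial_ne_zero
    field_simp
    ring

theorem inner_volume_volume :
    inner ℂ (divPow (omega V) (finrank ℂ V)) (divPow (omega V) (finrank ℂ V)) = 1 := by
  conv_lhs => rw [← mul_one (divPow (omega V) (finrank ℂ V))]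
  rw [← inner_lefschetzAdjointPow_right, mul_one, lefschetzAdjointPow_volume (j := 0) (by omega),
    divPow_zero, inner_one_one]

theorem eq_inner_smul_volume {x : Forms V} (hx : x ∈ ⋀[ℂ]^(2 * finrank ℂ V) (Covector V)) :
    x = inner ℂ (divPow (omega V) (finrank ℂ V)) x • divPow (omega V) (finrank ℂ V) := by
  have hfin : FiniteDimensional ℂ (Covector V) := (coframe V).finiteDimensional_of_finite
  have hW : finrank ℂ (Covector V) = 2 * finrank ℂ V := by
    rw [finrank_eq_card_basis (coframe V), Fintype.card_lex, Fintype.card_prod, Fintype.card_fin,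
      Fintype.card_fin, mul_comm]
  have h1 : finrank ℂ (⋀[ℂ]^(2 * finrank ℂ V) (Covector V)) = 1 := by
    rw [exteriorPower.finrank_eq, hW, Nat.choose_self]
  have hne : (⟨_, divPow_omega_mem_degree _⟩ : ⋀[ℂ]^(2 * finrank ℂ V) (Covector V)) ≠ 0 := by
    intro h
    have h2 := inner_volume_volume (V := V)
    rw [show divPow (omega V) (finrank ℂ V) = 0 from congrArg Subtype.val h, inner_zero_left] at h2
    exact zero_ne_one h2
  obtain ⟨c, hc⟩ := (finrank_eq_one_iff_of_nonzero' _ hne).mp h1 ⟨x, hx⟩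
  have hc' : c • divPow (omega V) (finrank ℂ V) = x := congrArg Subtype.val hc
  rw [← hc', inner_smul_right, inner_volume_volume, mul_one]

/-! ### Exponentials -/

/-- The form `exp ω`. -/
def expOmega (V : Type*) [NormedAddCommGroup V] [InnerProductSpace ℂ V]
    [FiniteDimensional ℂ V] : Forms V :=
  -- Stopping at `n` loses nothing, by `divPow_omega_eq_zero`.
  ∑ m ∈ Finset.range (finrank ℂ V + 1), divPow (omega V) m

/-- The operator `exp (t Λ)`. -/
def expLefschetzAdjoint (t : ℂ) (x : Forms V) : Forms V :=
  ∑ m ∈ Finset.range (finrank ℂ V + 1), t ^ m • lefschetzAdjointPow V m x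

theorem expLefschetzAdjoint_add (t : ℂ) (x y : Forms V) :
    expLefschetzAdjoint t (x + y) = expLefschetzAdjoint t x + expLefschetzAdjoint t y := by
  simp only [expLefschetzAdjoint, map_add, smul_add, Finset.sum_add_distrib]

theorem expLefschetzAdjoint_smul (t c : ℂ) (x : Forms V) :
    expLefschetzAdjoint t (c • x) = c • expLefschetzAdjoint t x := by
  simp only [expLefschetzAdjoint, map_smul, Finset.smul_sum, smul_comm c]

/-- Conjugation by `e^{tΛ}` turns `α ∧` into `α ∧ - t i_{Jα}`: the series stops there because the
commutator commutes with `Λ`. -/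
theorem expLefschetzAdjoint_ι_mul (t : ℂ) (α : Covector V) (x : Forms V) :
    expLefschetzAdjoint t (ι ℂ α * x) = ι ℂ α * expLefschetzAdjoint t x -
      t • interior (conjRot α) (expLefschetzAdjoint t x) := by
  -- The index shift leaves this top term over; it vanishes because `Λ^[n+1] = 0`.
  have hlast : interior (conjRot α) (lefschetzAdjointPow V (finrank ℂ V) x) = 0 := by
    have h := lefschetzAdjointPow_ι_mul (finrank ℂ V) α x
    rw [lefschetzAdjointPow_eq_zero (Nat.lt_succ_self _),
      lefschetzAdjointPow_eq_zero (Nat.lt_succ_self _), mul_zero, zero_sub] at h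
    exact neg_eq_zero.mp h.symm
  have h1 : interior (conjRot α) (expLefschetzAdjoint t x) =
      ∑ m ∈ Finset.range (finrank ℂ V),
        t ^ m • interior (conjRot α) (lefschetzAdjointPow V m x) := by
    rw [expLefschetzAdjoint, map_sum, Finset.sum_range_succ, map_smul, hlast, smul_zero, add_zero]
    simp only [map_smul]
  rw [h1, expLefschetzAdjoint, expLefschetzAdjoint, Finset.sum_range_succ', Finset.sum_range_succ',
    mul_add, Finset.mul_sum, Finset.smul_sum, lefschetzAdjointPow_zero, lefschetzAdjointPow_zero,
    mul_smul_comm, add_sub_right_comm, ← Finset.sum_sub_distrib]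
  congr 1
  refine Finset.sum_congr rfl fun m _ => ?_
  rw [lefschetzAdjointPow_ι_mul, smul_sub, mul_smul_comm, smul_smul, ← pow_succ']

theorem expLefschetzAdjoint_one (t : ℂ) : expLefschetzAdjoint t (1 : Forms V) = 1 := by
  have h : ∀ m, lefschetzAdjointPow V (m + 1) 1 = 0 := fun m =>
    lefschetzAdjointPow_eq_zero_of_degree (k := 0) (by omega)
      (by rw [ExteriorAlgebra.exteriorPower, pow_zero]; exact Submodule.one_le.mp le_rfl)
  rw [expLefschetzAdjoint, Finset.sum_range_succ', lefschetzAdjointPow_zero]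
  simp [h]

/-- By adjunction this is `e^Λ ω^[n] = e^ω`, where `Λ^[m]` sends `ω^[n]` to `ω^[n-m]`; hence the
reflected sum. -/
theorem inner_volume_expOmega_mul (x : Forms V) :
    inner ℂ (divPow (omega V) (finrank ℂ V)) (expOmega V * x) = inner ℂ (expOmega V) x := by
  rw [expOmega, Finset.sum_mul, inner_sum, sum_inner, ← Finset.sum_range_reflect]
  refine Finset.sum_congr rfl fun m hm => ?_
  rw [← inner_lefschetzAdjointPow_left, lefschetzAdjointPow_volume]
  have := Finset.mem_range.mp hm
  omega

/-! ### The polarized Hodge-Riemann pairing. -/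

/-- The anti-automorphism of the forms which is `-1` on covectors. -/
def antiInvolution : Forms V →ₗ[ℂ] Forms V :=
  CliffordAlgebra.reverse.comp CliffordAlgebra.involute.toLinearMap

theorem antiInvolution_one : antiInvolution (1 : Forms V) = 1 := by
  simp [antiInvolution]

theorem antiInvolution_ι_mul (α : Covector V) (x : Forms V) :
    antiInvolution (ι ℂ α * x) = -(antiInvolution x * ι ℂ α) := by
  have h1 : CliffordAlgebra.involute (ι ℂ α : Forms V) = -ι ℂ α :=
    CliffordAlgebra.involute_ι (Q := 0) α
  have h2 : CliffordAlgebra.reverse (ι ℂ α : Forms V) = ι ℂ α :=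
    CliffordAlgebra.reverse_ι (Q := 0) α
  simp only [antiInvolution, LinearMap.comp_apply, AlgHom.toLinearMap_apply, map_mul,
    CliffordAlgebra.reverse.map_mul, h1, map_neg, h2, mul_neg]

/-- The polarized form of the Hodge-Riemann pairing in all degrees at once. -/
theorem inner_volume_expOmega_antiInvolution (x y : Forms V) :
    inner ℂ (divPow (omega V) (finrank ℂ V))
      (expOmega V * (antiInvolution y * conjWeil x)) =
    inner ℂ (expLefschetzAdjoint 1 x) (expLefschetzAdjoint (-1) y) := by
  induction y using CliffordAlgebra.left_induction generalizing x with
  | algebraMap r =>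
    have hE : conjWeil (expOmega V) = expOmega V := by
      simp [expOmega, divPow, conjWeil_pow, conjWeil_omega]
    have h1 : inner ℂ (expLefschetzAdjoint 1 x) 1 = inner ℂ x (expOmega V) := by
      rw [expLefschetzAdjoint, expOmega, sum_inner, inner_sum]
      refine Finset.sum_congr rfl fun m _ => ?_
      rw [one_pow, one_smul, inner_lefschetzAdjointPow_left, mul_one]
    change inner ℂ _ (expOmega V * (antiInvolution (algebraMap ℂ (Forms V) r) * conjWeil x)) =
      inner ℂ _ (expLefschetzAdjoint (-1) (algebraMap ℂ (Forms V) r))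
    rw [Algebra.algebraMap_eq_smul_one, map_smul, antiInvolution_one, expLefschetzAdjoint_smul,
      expLefschetzAdjoint_one, smul_one_mul, mul_smul_comm, inner_smul_right, inner_smul_right,
      inner_volume_expOmega_mul, h1, ← inner_conjWeil (expOmega V) x, hE]
  | add y z hy hz =>
    rw [map_add, add_mul, mul_add, inner_add_right, expLefschetzAdjoint_add, inner_add_right,
      hy, hz]
  | ι_mul y α hy =>
    -- The sign of `antiInvolution` on `α` is absorbed by `J² = -1`: the factor `-α` is `C` applied
    -- to `Jα`.
    have h : antiInvolution (ι ℂ α * y) * conjWeil x =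
        antiInvolution y * conjWeil (ι ℂ (conjRot α) * x) := by
      rw [antiInvolution_ι_mul, conjWeil_mul, conjWeil_ι, conjRot_conjRot, map_neg, neg_mul,
        neg_mul, mul_neg, mul_assoc]
    change inner ℂ _ (expOmega V * (antiInvolution (ι ℂ α * y) * conjWeil x)) =
      inner ℂ _ (expLefschetzAdjoint (-1) (ι ℂ α * y))
    -- With `t = 1` on `Jα ∧ x` and `t = -1` on `α ∧ y`, the resulting operators `Jα ∧ + i_α` and `α
    -- ∧ + i_{Jα}` are adjoint.
    rw [h, hy, expLefschetzAdjoint_ι_mul, expLefschetzAdjoint_ι_mul, conjRot_conjRot,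
      interior_neg, one_smul, sub_neg_eq_add, neg_one_smul, sub_neg_eq_add, inner_add_left,
      inner_add_right, inner_ι_mul_right, ← inner_ι_mul_left, add_comm]

/-- Reversing `k` covectors costs `(-1)^(k(k-1)/2)`, and negating each of them costs `(-1)^k`. -/
theorem antiInvolution_apply_of_mem_degree {k : ℕ} {x : Forms V}
    (hx : x ∈ ⋀[ℂ]^k (Covector V)) :
    antiInvolution x = (-1 : ℂ) ^ (k * (k + 1) / 2) • x := by
  have hswap : ∀ (α : Covector V) (k : ℕ) (a : Fin k → Covector V),
      (ιMulti ℂ k a * ι ℂ α : Forms V) = (-1 : ℂ) ^ k • (ι ℂ α * ιMulti ℂ k a) := by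
    intro α k a
    induction k with
    | zero => simp [ExteriorAlgebra.ιMulti_zero_apply]
    | succ k ih =>
      rw [ιMulti_succ_eq, mul_assoc, ih, mul_smul_comm, ← mul_assoc, ι_mul_ι_comm, neg_mul,
        mul_assoc, pow_succ, mul_neg_one, neg_smul, smul_neg]
  refine forms_degree_induction
    (P := fun x => antiInvolution x = (-1 : ℂ) ^ (k * (k + 1) / 2) • x)
    (by simp) (fun x y hx hy => ?_) (fun c x hx => ?_) (fun a => ?_) hx
  · rw [map_add, hx, hy, smul_add]
  · rw [map_smul, hx, smul_comm]
  · clear hx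
    induction k with
    | zero => simp [ExteriorAlgebra.ιMulti_zero_apply, antiInvolution_one]
    | succ k ih =>
      have hk : (k + 1) * (k + 1 + 1) / 2 = k * (k + 1) / 2 + (k + 1) := by
        rw [show (k + 1) * (k + 1 + 1) = k * (k + 1) + (k + 1) * 2 by ring,
          Nat.add_mul_div_right _ _ two_pos]
      rw [ιMulti_succ_eq, antiInvolution_ι_mul, ih, smul_mul_assoc, hswap, smul_smul, hk, pow_add,
        pow_succ _ k, mul_neg_one, mul_neg, neg_smul]

/-- The polarized Hodge-Riemann pairing of two forms of degree `k`. -/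
theorem inner_volume_expOmega_mul_conjWeil {k : ℕ} {x y : Forms V}
    (hx : x ∈ ⋀[ℂ]^k (Covector V)) (hy : y ∈ ⋀[ℂ]^k (Covector V)) :
    (-1 : ℂ) ^ (k * (k + 1) / 2) * inner ℂ (divPow (omega V) (finrank ℂ V))
      (expOmega V * (y * conjWeil x)) =
    ∑ m ∈ Finset.range (finrank ℂ V + 1),
      (-1 : ℂ) ^ m * inner ℂ (lefschetzAdjointPow V m x) (lefschetzAdjointPow V m y) := by
  have h := inner_volume_expOmega_antiInvolution x y
  rw [antiInvolution_apply_of_mem_degree hy, smul_mul_assoc, mul_smul_comm, inner_smul_right] at h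
  rw [h, expLefschetzAdjoint, expLefschetzAdjoint, sum_inner]
  refine Finset.sum_congr rfl fun m hm => ?_
  -- Cross terms vanish: `Λ^[m] x` and `Λ^[m'] y` have different degrees `k - 2m` and `k - 2m'`, or
  -- one of them is zero.
  rw [inner_sum, Finset.sum_eq_single_of_mem m hm, one_pow, one_smul, inner_smul_right]
  intro m' _ hne
  rw [one_pow, one_smul, inner_smul_right]
  by_cases h1 : k < 2 * m
  · rw [lefschetzAdjointPow_eq_zero_of_degree h1 hx, inner_zero_left, mul_zero]
  by_cases h2 : k < 2 * m'
  · rw [lefschetzAdjointPow_eq_zero_of_degree h2 hy, inner_zero_right, mul_zero]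
  obtain ⟨j, rfl⟩ := Nat.exists_eq_add_of_le (not_lt.mp h1)
  obtain ⟨j', hj'⟩ := Nat.exists_eq_add_of_le (not_lt.mp h2)
  rw [inner_eq_zero_of_degree_ne (j := j) (k := j') (by omega)
    (lefschetzAdjointPow_mem_degree hx) (lefschetzAdjointPow_mem_degree (hj' ▸ hy)), mul_zero]

/-- Pairing with the volume form selects from `e^ω` the one power that reaches top degree. If `j >
n` there is none, in agreement with the convention for negative exponents. -/
theorem mul_divPowInt_omega {j : ℕ} {x y : Forms V} (hx : x ∈ ⋀[ℂ]^j (Covector V))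
    (hy : y ∈ ⋀[ℂ]^j (Covector V)) :
    x * y * divPowInt (omega V) ((finrank ℂ V : ℤ) - j) =
      inner ℂ (divPow (omega V) (finrank ℂ V)) (expOmega V * (x * y)) •
        divPow (omega V) (finrank ℂ V) := by
  have hxy := mul_mem_degree hx hy
  have hterm : ∀ m, m + j ≠ finrank ℂ V →
      inner ℂ (divPow (omega V) (finrank ℂ V)) (divPow (omega V) m * (x * y)) = 0 := fun m hm =>
    inner_eq_zero_of_degree_ne (by omega) (divPow_omega_mem_degree _)
      (mul_mem_degree (divPow_omega_mem_degree m) hxy)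
  rw [expOmega, Finset.sum_mul, inner_sum]
  by_cases hj : j ≤ finrank ℂ V
  · obtain ⟨r, hr⟩ := Nat.exists_eq_add_of_le hj
    have hr' : (finrank ℂ V : ℤ) - j = r := by rw [hr]; push_cast; ring
    have hcomm : x * y * divPow (omega V) r = divPow (omega V) r * (x * y) := by
      have h : Commute (omega V) (x * y) := omega_mul_comm _
      rw [divPow, mul_smul_comm, smul_mul_assoc, (h.pow_left r).eq]
    rw [hr', divPowInt, if_pos (Int.natCast_nonneg r), Int.toNat_natCast, hcomm,
      Finset.sum_eq_single_of_mem r (Finset.mem_range.mpr (by omega))]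
    · refine eq_inner_smul_volume ?_
      have h := mul_mem_degree (divPow_omega_mem_degree (V := V) r) hxy
      rwa [show 2 * r + (j + j) = 2 * finrank ℂ V by omega] at h
    · exact fun m _ hm => hterm m (by omega)
  · rw [divPowInt, if_neg (by omega), mul_zero, Finset.sum_eq_zero fun m _ => hterm m (by omega),
      zero_smul]

end Lefschetz

/-! ### The coefficient sequence -/

/-- The solution of the recursion of `IsRecipBesselSeq`. -/
def recipBessel : ℕ → ℤ
  | 0 => 1
  | p + 1 => -∑ l : Fin (p + 1),
      (-1) ^ (p + 1 + (l : ℕ)) * ((p + 1).choose l : ℤ) ^ 2 * recipBessel l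

theorem isRecipBesselSeq_succ {c : ℕ → ℤ} (hc : IsRecipBesselSeq c) (p : ℕ) :
    c (p + 1) = -∑ l : Fin (p + 1),
      (-1) ^ (p + 1 + (l : ℕ)) * ((p + 1).choose l : ℤ) ^ 2 * c l := by
  have h := hc.2 (p + 1) (Nat.succ_pos p)
  rw [Finset.sum_range_succ, Nat.choose_self] at h
  have h2 : ((-1 : ℤ) ^ (p + 1)) * (-1) ^ (p + 1) = 1 := by rw [← mul_pow]; simp
  rw [Fin.sum_univ_eq_sum_range
    (fun l => (-1 : ℤ) ^ (p + 1 + l) * ((p + 1).choose l : ℤ) ^ 2 * c l)]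
  simp only [pow_add _ (p + 1), mul_assoc, ← Finset.mul_sum] at h ⊢
  push_cast at h
  linear_combination (-1 : ℤ) ^ (p + 1) * h - c (p + 1) * h2

theorem isRecipBesselSeq_recipBessel : IsRecipBesselSeq recipBessel := by
  refine ⟨by rw [recipBessel], fun p hp => ?_⟩
  obtain ⟨p, rfl⟩ := Nat.exists_eq_add_of_le' hp
  have h2 : ((-1 : ℤ) ^ (p + 1)) * (-1) ^ (p + 1) = 1 := by rw [← mul_pow]; simp
  rw [Finset.sum_range_succ, Nat.choose_self, recipBessel, Fin.sum_univ_eq_sum_range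
    (fun l => (-1 : ℤ) ^ (p + 1 + l) * ((p + 1).choose l : ℤ) ^ 2 * recipBessel l)]
  simp only [pow_add _ (p + 1), mul_assoc, ← Finset.mul_sum]
  push_cast
  linear_combination -(∑ l ∈ Finset.range (p + 1),
    (-1 : ℤ) ^ l * (((p + 1).choose l : ℤ) ^ 2 * recipBessel l)) * h2

theorem isRecipBesselSeq_unique {b c : ℕ → ℤ} (hb : IsRecipBesselSeq b)
    (hc : IsRecipBesselSeq c) : c = b := by
  funext p
  induction p using Nat.strong_induction_on with
  | _ p ih =>
    cases p with
    | zero => rw [hb.1, hc.1]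
    | succ p =>
      rw [isRecipBesselSeq_succ hb, isRecipBesselSeq_succ hc]
      congr 1
      exact Finset.sum_congr rfl fun l _ => by rw [ih l l.2]

/-- The `p`-th coefficient of the product is `(-1)^p / (p!)²` times the sum in the recursion. -/
theorem mk_mul_mk_eq_one {b : ℕ → ℤ} (hb : IsRecipBesselSeq b) :
    (PowerSeries.mk fun m : ℕ => ((-1) ^ m / ((m ! : ℕ) : ℚ) ^ 2 : ℚ)) *
      (PowerSeries.mk fun l : ℕ => ((b l : ℚ) / ((l ! : ℕ) : ℚ) ^ 2 : ℚ)) = 1 := by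
  ext p
  rw [mul_comm, PowerSeries.coeff_mul, PowerSeries.coeff_one,
    Finset.Nat.sum_antidiagonal_eq_sum_range_succ_mk]
  simp only [PowerSeries.coeff_mk]
  have hterm : ∀ l ∈ Finset.range (p + 1),
      (b l : ℚ) / ((l ! : ℕ) : ℚ) ^ 2 * ((-1) ^ (p - l) / (((p - l) ! : ℕ) : ℚ) ^ 2) =
      (-1) ^ p / ((p ! : ℕ) : ℚ) ^ 2 *
        (((-1) ^ l * (p.choose l : ℤ) ^ 2 * b l : ℤ) : ℚ) := by
    intro l hl
    have hlp : l ≤ p := Nat.lt_succ_iff.mp (Finset.mem_range.mp hl)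
    have hp : ((p ! : ℕ) : ℚ) ≠ 0 := by exact_mod_cast p.factorial_ne_zero
    have hl : ((l ! : ℕ) : ℚ) ≠ 0 := by exact_mod_cast l.factorial_ne_zero
    have hpl : (((p - l) ! : ℕ) : ℚ) ≠ 0 := by exact_mod_cast (p - l).factorial_ne_zero
    have hs : (-1 : ℚ) ^ (p - l) = (-1) ^ p * (-1) ^ l := by
      obtain ⟨r, rfl⟩ := Nat.exists_eq_add_of_le hlp
      rw [Nat.add_sub_cancel_left, pow_add, mul_right_comm, ← mul_pow]
      simp
    push_cast
    rw [hs, Nat.cast_choose ℚ hlp]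
    field_simp
  rw [Finset.sum_congr rfl hterm, ← Finset.mul_sum, ← Int.cast_sum]
  cases p with
  | zero => simp [hb.1]
  | succ p =>
    rw [hb.2 _ (Nat.succ_pos p), if_neg (Nat.succ_ne_zero p)]
    simp

/-- Grouping by `p = m + l`, the coefficient of `a p` is `(-1)^p` times the sum in the recursion.
The vanishing of `a` beyond `n` cuts the square of indices down to the triangle `m + l ≤ n`. -/
theorem sum_mul_sum_choose_sq {b : ℕ → ℤ} (hb : IsRecipBesselSeq b) (n : ℕ) (a : ℕ → ℂ)
    (ha : ∀ p, n < p → a p = 0) :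
    ∑ l ∈ Finset.range (n + 1), (b l : ℂ) * ∑ m ∈ Finset.range (n + 1),
      (-1 : ℂ) ^ m * ((m + l).choose l : ℂ) ^ 2 * a (m + l) = a 0 := by
  have h1 : ∀ l ∈ Finset.range (n + 1), (b l : ℂ) * ∑ m ∈ Finset.range (n + 1),
      (-1 : ℂ) ^ m * ((m + l).choose l : ℂ) ^ 2 * a (m + l) =
      ∑ m ∈ Finset.range (n + 1 - l),
        (b l : ℂ) * ((-1 : ℂ) ^ m * ((m + l).choose l : ℂ) ^ 2 * a (m + l)) := by
    intro l _
    rw [Finset.mul_sum]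
    refine (Finset.sum_subset (Finset.range_mono (Nat.sub_le _ _)) fun m _ hm => ?_).symm
    rw [ha _ (by rw [Finset.mem_range] at hm; omega), mul_zero, mul_zero]
  rw [Finset.sum_congr rfl h1, ← Finset.sum_range_diag_flip (n + 1)
    (fun l m => (b l : ℂ) * ((-1 : ℂ) ^ m * ((m + l).choose l : ℂ) ^ 2 * a (m + l)))]
  have h2 : ∀ p, ∑ l ∈ Finset.range (p + 1),
      (b l : ℂ) * ((-1 : ℂ) ^ (p - l) * ((p - l + l).choose l : ℂ) ^ 2 * a (p - l + l)) =
      (-1) ^ p * a p * ((∑ l ∈ Finset.range (p + 1),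
        (-1) ^ l * (p.choose l : ℤ) ^ 2 * b l : ℤ) : ℂ) := by
    intro p
    push_cast
    rw [Finset.mul_sum]
    refine Finset.sum_congr rfl fun l hl => ?_
    obtain ⟨r, rfl⟩ := Nat.exists_eq_add_of_le (Nat.lt_succ_iff.mp (Finset.mem_range.mp hl))
    have hs : (-1 : ℂ) ^ l * (-1) ^ l = 1 := by rw [← mul_pow]; simp
    rw [Nat.add_sub_cancel_left, add_comm r l, pow_add]
    linear_combination (-(b l : ℂ) * (-1) ^ r * ((l + r).choose l : ℂ) ^ 2 * a (l + r)) * hs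
  rw [Finset.sum_congr rfl fun p _ => h2 p, Finset.sum_eq_single_of_mem 0 (by simp)]
  · simp [hb.1]
  · intro p _ hp
    rw [hb.2 p (Nat.one_le_iff_ne_zero.mpr hp), Int.cast_zero, mul_zero]

/-! ### The norm formula. -/

theorem norm_sq_smul_volume {V : Type*} [NormedAddCommGroup V] [InnerProductSpace ℂ V]
    [FiniteDimensional ℂ V] {b : ℕ → ℤ} (hb : IsRecipBesselSeq b) {k : ℕ} {u : Forms V}
    (hu : u ∈ ⋀[ℂ]^k (Covector V)) :
    ((-1 : ℂ) ^ (k * (k + 1) / 2) * ((‖u‖ ^ 2 : ℝ) : ℂ)) • divPow (omega V) (finrank ℂ V) =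
      ∑ l ∈ Finset.range (finrank ℂ V + 1), ((-1 : ℂ) ^ l * (b l : ℂ)) •
        (lefschetzAdjointPow V l u * lefschetzAdjointPow V l (conjForm V (weilOp V u)) *
          divPowInt (omega V) ((finrank ℂ V : ℤ) - (k : ℤ) + 2 * (l : ℤ))) := by
  -- The Hodge-Riemann pairing of `Λ^[l] u` with itself; the squared binomial coefficient comes from
  -- `Λ^[m] Λ^[l]` in both arguments.
  have hterm : ∀ l, (-1 : ℂ) ^ l •
      (lefschetzAdjointPow V l u * lefschetzAdjointPow V l (conjForm V (weilOp V u)) *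
        divPowInt (omega V) ((finrank ℂ V : ℤ) - (k : ℤ) + 2 * (l : ℤ))) =
      ((-1 : ℂ) ^ (k * (k + 1) / 2) * ∑ m ∈ Finset.range (finrank ℂ V + 1),
        (-1 : ℂ) ^ m * ((m + l).choose l : ℂ) ^ 2 *
          ((‖lefschetzAdjointPow V (m + l) u‖ ^ 2 : ℝ) : ℂ)) •
        divPow (omega V) (finrank ℂ V) := by
    intro l
    by_cases hkl : k < 2 * l
    · have h0 : ∀ m, lefschetzAdjointPow V (m + l) u = 0 := fun m =>
        lefschetzAdjointPow_eq_zero_of_degree (by omega) hu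
      have h1 := h0 0
      rw [zero_add] at h1
      simp [h0, h1]
    obtain ⟨j, rfl⟩ := Nat.exists_eq_add_of_le (not_lt.mp hkl)
    have hx := lefschetzAdjointPow_mem_degree hu
    have hexp : (finrank ℂ V : ℤ) - ((2 * l + j : ℕ) : ℤ) + 2 * (l : ℤ) =
        (finrank ℂ V : ℤ) - j := by push_cast; ring
    -- Lowering the degree by `2 * l` changes the sign by `(-1)^l`, which accounts for the factor
    -- `(-1)^l` in the theorem.
    have hsign : (-1 : ℂ) ^ ((2 * l + j) * (2 * l + j + 1) / 2) =
        (-1) ^ l * (-1) ^ (j * (j + 1) / 2) := by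
      have h : (2 * l + j) * (2 * l + j + 1) / 2 = j * (j + 1) / 2 + l + 2 * (l * l + l * j) := by
        rw [show (2 * l + j) * (2 * l + j + 1) =
          j * (j + 1) + (l + 2 * (l * l + l * j)) * 2 by ring, Nat.add_mul_div_right _ _ two_pos,
          add_assoc]
      rw [h, pow_add, pow_add, pow_mul]
      simp [mul_comm]
    have hs : (-1 : ℂ) ^ (j * (j + 1) / 2) * (-1) ^ (j * (j + 1) / 2) = 1 := by
      rw [← mul_pow]; simp
    have hmain := inner_volume_expOmega_mul_conjWeil hx hx
    have hsum : ∀ m, inner ℂ (lefschetzAdjointPow V m (lefschetzAdjointPow V l u))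
        (lefschetzAdjointPow V m (lefschetzAdjointPow V l u)) =
        ((m + l).choose l : ℂ) ^ 2 * ((‖lefschetzAdjointPow V (m + l) u‖ ^ 2 : ℝ) : ℂ) := by
      intro m
      have hnorm (x : Forms V) : inner ℂ x x = ((‖x‖ ^ 2 : ℝ) : ℂ) :=
        (inner_self_eq_norm_sq_to_K x).trans (Complex.ofReal_pow _ _).symm
      rw [lefschetzAdjointPow_lefschetzAdjointPow, inner_smul_left, inner_smul_right, hnorm,
        Complex.conj_natCast, ← mul_assoc, ← pow_two]
    rw [Finset.sum_congr rfl fun m _ => by rw [hsum, ← mul_assoc]] at hmain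
    rw [conjWeil_apply, ← conjWeil_lefschetzAdjointPow, hexp,
      mul_divPowInt_omega hx (conjWeil_mem_degree hx), smul_smul, hsign, mul_assoc ((-1 : ℂ) ^ l),
      ← hmain, ← mul_assoc ((-1 : ℂ) ^ (j * (j + 1) / 2)), hs, one_mul]
  have hsum := sum_mul_sum_choose_sq hb (finrank ℂ V)
    (fun p => ((‖lefschetzAdjointPow V p u‖ ^ 2 : ℝ) : ℂ))
    (fun p hp => by simp [lefschetzAdjointPow_eq_zero hp])
  rw [lefschetzAdjointPow_zero] at hsum
  rw [← hsum, Finset.mul_sum, Finset.sum_smul]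
  refine Finset.sum_congr rfl fun l _ => ?_
  rw [mul_comm ((-1 : ℂ) ^ l), mul_smul (b l : ℂ), hterm, smul_smul, mul_left_comm]

end HermitianForms

end

theorem mainTheorem1 :
    ∃ b : ℕ → ℤ,
      -- the recursion holds for `b`, and only for `b`
      (∀ c : ℕ → ℤ, HermitianForms.IsRecipBesselSeq c ↔ c = b) ∧
      -- `∑ b_l z^l / (l!)^2` is the reciprocal of `J_0(2 √z) = ∑ (-1)^m z^m / (m!)^2`
      (PowerSeries.mk fun m : ℕ => ((-1) ^ m / ((m ! : ℕ) : ℚ) ^ 2 : ℚ)) *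
          (PowerSeries.mk fun l : ℕ => ((b l : ℚ) / ((l ! : ℕ) : ℚ) ^ 2 : ℚ)) = 1 ∧
      ∀ (V : Type*) [NormedAddCommGroup V] [InnerProductSpace ℂ V] [FiniteDimensional ℂ V]
        (n k : ℕ), Module.finrank ℂ V = n →
        ∀ u : HermitianForms.Forms V, u ∈ ⋀[ℂ]^k (HermitianForms.Covector V) →
          ((-1 : ℂ) ^ (k * (k + 1) / 2) * ((‖u‖ ^ 2 : ℝ) : ℂ)) •
              HermitianForms.divPow (HermitianForms.omega V) n =
            ∑ l ∈ Finset.range (n + 1), ((-1 : ℂ) ^ l * (b l : ℂ)) •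
              (HermitianForms.divPow (HermitianForms.lefschetzAdjoint V) l u *
                HermitianForms.divPow (HermitianForms.lefschetzAdjoint V) l
                  (HermitianForms.conjForm V (HermitianForms.weilOp V u)) *
                HermitianForms.divPowInt (HermitianForms.omega V)
                  ((n : ℤ) - (k : ℤ) + 2 * (l : ℤ))) := by
  refine ⟨HermitianForms.recipBessel, fun c => ⟨fun hc =>
    HermitianForms.isRecipBesselSeq_unique HermitianForms.isRecipBesselSeq_recipBessel hc, ?_⟩,
    HermitianForms.mk_mul_mk_eq_one HermitianForms.isRecipBesselSeq_recipBessel, ?_⟩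
  · rintro rfl
    exact HermitianForms.isRecipBesselSeq_recipBessel
  · rintro V _ _ _ n k rfl u hu
    exact HermitianForms.norm_sq_smul_volume HermitianForms.isRecipBesselSeq_recipBessel hu
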